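/- Let $\mathbb{C}P^2$ carry the Fubini--Study metric. Let $M\subset\mathbb{C}$ be one of the following domains: $\mathbb{C}^*=\mathbb{C}\setminus\{0\}$, $\mathbf{D}^*=\{0<|z|<1\}$, or $\mathbf{D}_r=\{r<|z|<1/r\}$ with $0<r<1$. Let $f:M\to\mathbb{C}P^2$ be a smooth minimal Lagrangian immersion that is conformal with respect to the complex structure of $M$. Suppose that $f$ is rotationally equivariant, i.e. there is a (continuous) one-parameter group $R(t)$, $t\in\mathbb{R}$, of isometries of $\mathbb{C}P^2$ with $f(e^{it}z)=R(t)f(z)$ for all $z\in M$, $t\in\mathbb{R}$. Then there are conformal minimal Lagrangian immersions $\hat f:\mathbb{C}^*\to\mathbb{C}P^2$ and $\tilde f:\mathbb{C}\to\mathbb{C}P^2$ such that 1. $\hat f$ is rotationally equivariant and extends $f$, i.e. $\hat f|_M=f$; 2. $\tilde f$ is translationally equivariant, i.e. there is a (continuous) one-parameter group $\tilde R(t)$ of isometries of $\mathbb{C}P^2$ with $\tilde f(w+t)=\tilde R(t)\tilde f(w)$ for all $w\in\mathbb{C}$, $t\in\mathbb{R}$, and $\tilde f$ is $2\pi$-periodic,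 $\tilde f(w+2\pi)=\tilde f(w)$; 3. $\hat f$ is obtained from $\tilde f$ by projection along the covering $w\mapsto e^{iw}$ of $\mathbb{C}^*$, i.e. $\hat f(e^{iw})=\tilde f(w)$ for all $w\in\mathbb{C}$. -/

import Mathlib

open scoped ContDiff Topology LinearAlgebra.Projectivization

noncomputable section

/-- The Hermitian space `ℂ³`. -/
abbrev C3 : Type := EuclideanSpace ℂ (Fin 3)

/-- The complex projective plane. -/
abbrev CP2 : Type := ℙ ℂ C3

/-- The geodesic distance of the Fubini-Study metric (normalized so that `S⁵(1) → ℂP²` is a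
Riemannian submersion): `cos d([v], [w]) = |⟨v, w⟩| / (‖v‖ ‖w‖)`. -/
def fsDist (p q : CP2) : ℝ :=
  Real.arccos (‖inner ℂ p.rep q.rep‖ / (‖p.rep‖ * ‖q.rep‖))

/-- The distance can be computed with arbitrary representatives. -/
theorem fsDist_mk (v w : C3) (hv : v ≠ 0) (hw : w ≠ 0) :
    fsDist (Projectivization.mk ℂ v hv) (Projectivization.mk ℂ w hw) =
      Real.arccos (‖inner ℂ v w‖ / (‖v‖ * ‖w‖)) := by
  obtain ⟨a, ha⟩ := Projectivization.exists_smul_eq_mk_rep ℂ v hv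
  obtain ⟨b, hb⟩ := Projectivization.exists_smul_eq_mk_rep ℂ w hw
  have ha0 : ‖(a : ℂ)‖ ≠ 0 := by simp
  have hb0 : ‖(b : ℂ)‖ ≠ 0 := by simp
  have hv0 : ‖v‖ ≠ 0 := by simpa using hv
  have hw0 : ‖w‖ ≠ 0 := by simpa using hw
  rw [fsDist, ← ha, ← hb, Units.smul_def, Units.smul_def, inner_smul_left, inner_smul_right,
    norm_smul, norm_smul, norm_mul, norm_mul, RCLike.norm_conj]
  congr 1
  field_simp

/-- A (continuous) one-parameter group of isometries of `ℂP²`. -/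
structure IsOneParameterIsometryGroup (R : ℝ → Equiv.Perm CP2) : Prop where
  isometry : ∀ t p q, fsDist (R t p) (R t q) = fsDist p q
  add : ∀ s t, R (s + t) = R s * R t
  continuous : ∀ p s, Filter.Tendsto (fun t => fsDist (R t p) (R s p)) (𝓝 s) (𝓝 0)

/-! ### Maps into `ℂP²` in terms of local lifts to `ℂ³ \ {0}`

For `L = ℂ v` one has `T_L ℂP² = Hom(L, L^⊥)`.  Along a map with local lift `F`, a tangent vector
`σ ∈ Hom(L, L^⊥)` is represented by the vector `σ(F) ∈ F^⊥`. -/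

/-- `F` is a smooth lift of `f` to `ℂ³ \ {0}` on the open set `V`. -/
structure IsLocalLift (F : ℂ → C3) (f : ℂ → CP2) (V : Set ℂ) : Prop where
  isOpen : IsOpen V
  smooth : ContDiffOn ℝ ∞ F V
  lift : ∀ z ∈ V, ∃ h : F z ≠ 0, f z = Projectivization.mk ℂ (F z) h

/-- The coefficient of `v` in the orthogonal decomposition `ℂ³ = ℂ v ⊕ v^⊥` of `w`. -/
def lineCoeff (v w : C3) : ℂ := inner ℂ v w / inner ℂ v v

/-- The component of `w` in `v^⊥`. -/
def horPart (v w : C3) : C3 := w - lineCoeff v w • v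

/-- `df(X)`, represented by the projection of `∂_X F` to `F^⊥`. -/
def tangentVec (F : ℂ → C3) (X : ℂ) (z : ℂ) : C3 :=
  horPart (F z) (fderiv ℝ F z X)

/-- The pull-back under `f = [F]` of the Hermitian form of the Fubini-Study metric. -/
def fsHermitian (F : ℂ → C3) (z : ℂ) (X Y : ℂ) : ℂ :=
  inner ℂ (tangentVec F X z) (tangentVec F Y z) / ((‖F z‖ ^ 2 : ℝ) : ℂ)

/-- The pull-back of the Fubini-Study Riemannian metric. -/
def inducedMetric (F : ℂ → C3) (z : ℂ) (X Y : ℂ) : ℝ := (fsHermitian F z X Y).re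

/-- The pull-back of the Kähler form (up to sign convention). -/
def inducedKahlerForm (F : ℂ → C3) (z : ℂ) (X Y : ℂ) : ℝ := (fsHermitian F z X Y).im

/-- The Levi-Civita connection of the Fubini-Study metric, pulled back under `f = [F]`:  for a
section `σ` of `f^* TℂP² = Hom(L, L^⊥)` represented by `W = σ(F)`, where `L` and `L^⊥` carry the
connections obtained by projecting the flat connection of `ℂ³`,
`(∇_X σ)(F) = pr_{L^⊥} (∂_X W) - σ(pr_L (∂_X F))`. -/
def covDeriv (F : ℂ → C3) (W : ℂ → C3) (X : ℂ) (z : ℂ) : C3 :=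
  horPart (F z) (fderiv ℝ W z X) - lineCoeff (F z) (fderiv ℝ F z X) • W z

/-- `∇_X (df(Y))` for constant vector fields `X`, `Y` on the plane. Its normal component is the
second fundamental form. -/
def secondDeriv (F : ℂ → C3) (X Y : ℂ) (z : ℂ) : C3 :=
  covDeriv F (tangentVec F Y) X z

/-- `f = [F]` is an immersion at `z` which is conformal with respect to the complex structure of
the domain, that is, the induced metric is `2 e^u dz dz̄`. -/
def IsConformalImmersionAt (F : ℂ → C3) (z : ℂ) : Prop :=
  0 < inducedMetric F z 1 1 ∧
  inducedMetric F z 1 1 = inducedMetric F z Complex.I Complex.I ∧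
  inducedMetric F z 1 Complex.I = 0

/-- `f = [F]` is Lagrangian at `z`. -/
def IsLagrangianAt (F : ℂ → C3) (z : ℂ) : Prop :=
  ∀ X Y : ℂ, inducedKahlerForm F z X Y = 0

/-- `det g` times the trace, with respect to the induced metric `g`, of `∇ df`. The normal component
of this vector is `2 det g` times the mean curvature vector. -/
def metricTrace (F : ℂ → C3) (z : ℂ) : C3 :=
  inducedMetric F z Complex.I Complex.I • secondDeriv F 1 1 z
    - inducedMetric F z 1 Complex.I • secondDeriv F 1 Complex.I z
    - inducedMetric F z 1 Complex.I • secondDeriv F Complex.I 1 z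
    + inducedMetric F z 1 1 • secondDeriv F Complex.I Complex.I z

/-- The mean curvature vector of `f = [F]` vanishes at `z`: the metric trace of `∇ df` is orthogonal
to every normal vector `ν ∈ F^⊥`. -/
def IsMinimalAt (F : ℂ → C3) (z : ℂ) : Prop :=
  ∀ ν : C3, inner ℂ (F z) ν = 0 → (∀ X : ℂ, (inner ℂ (tangentVec F X z) ν).re = 0) →
    (inner ℂ (metricTrace F z) ν).re = 0

/-- `f` is a smooth conformal minimal Lagrangian immersion of the open set `U ⊆ ℂ` into `ℂP²`.
(The three pointwise conditions do not depend on the choice of the local lift.) -/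
def IsMinimalLagrangianImmersion (f : ℂ → CP2) (U : Set ℂ) : Prop :=
  ∀ p ∈ U, ∃ (V : Set ℂ) (F : ℂ → C3), p ∈ V ∧ V ⊆ U ∧ IsLocalLift F f V ∧
    ∀ z ∈ V, IsConformalImmersionAt F z ∧ IsLagrangianAt F z ∧ IsMinimalAt F z

/-- `f : U → ℂP²` is equivariant relative to the one-parameter group `(γ t, R t)`. -/
def IsEquivariant (f : ℂ → CP2) (U : Set ℂ) (γ : ℝ → ℂ → ℂ) (R : ℝ → Equiv.Perm CP2) : Prop :=
  IsOneParameterIsometryGroup R ∧ ∀ t, ∀ p ∈ U, γ t p ∈ U ∧ f (γ t p) = R t (f p)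

/-- Equivariance under the group of all rotations about the origin. -/
def IsRotationallyEquivariant (f : ℂ → CP2) (U : Set ℂ) : Prop :=
  ∃ R : ℝ → Equiv.Perm CP2, IsEquivariant f U (fun t z => Complex.exp (t * Complex.I) * z) R

/-- Equivariance under the group of all real translations. -/
def IsTranslationallyEquivariant (f : ℂ → CP2) (U : Set ℂ) : Prop :=
  ∃ R : ℝ → Equiv.Perm CP2, IsEquivariant f U (fun t z => z + t) R

/-- `ℂ^*`. -/
def puncturedPlane : Set ℂ := {z | z ≠ 0}

/-- `𝐃^*`. -/
def puncturedDisk : Set ℂ := {z | 0 < ‖z‖ ∧ ‖z‖ < 1}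

/-- `𝐃_r`, for `0 < r < 1`. -/
def openAnnulus (r : ℝ) : Set ℂ := {z | r < ‖z‖ ∧ ‖z‖ < 1 / r}

end

/-!
On a neighbourhood of each point, a conformal minimal Lagrangian immersion into `ℂP²` has a lift `F`
to the unit sphere of `ℂ³` which is horizontal for the Hopf fibration and satisfies
`∂_I F = F × ∂₁F`, where `×` is the complex conjugate of the cross product. Such special lifts are
unique up to a cube root of unity, and conversely they project to conformal minimal Lagrangian
immersions.

The isometries `R t` form a connected group, so by Wigner's theorem they are induced by unitary, not
antiunitary, maps. In the coordinate `w` with `z = e^{iw}`, rotations become translations, and since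
special lifts are so rigid, `R` is induced by the one-parameter subgroup generated by some
`A ∈ su(3)` such that every special lift satisfies `∂₁F = A F` and `∂_I F = F × A F`. The vector
fields on the right are tangent to the spheres of `ℂ³`, hence complete, and their flows extend the
lift to the whole plane. Translation by `2π` multiplies the extended lift by a cube root of unity,
so the extended immersion is periodic and descends to the punctured plane.
-/

/-! ### Projective geometry of an inner product space -/

section Rep

variable {K V : Type*} [DivisionRing K] [AddCommGroup V] [Module K V] {v w : V} {p q : ℙ K V}

/-- `v` is a nonzero vector on the line `p`, that is, a vector of homogeneous coordinates of `p`. -/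
def IsRep (v : V) (p : ℙ K V) : Prop :=
  ∃ h : v ≠ 0, p = Projectivization.mk K v h

namespace IsRep

theorem ne_zero (h : IsRep v p) : v ≠ 0 := h.1

theorem mk (hv : v ≠ 0) : IsRep v (Projectivization.mk K v hv) := ⟨hv, rfl⟩

theorem rep (p : ℙ K V) : IsRep p.rep p := ⟨p.rep_nonzero, p.mk_rep.symm⟩

theorem unique (hp : IsRep v p) (hq : IsRep v q) : p = q := by
  obtain ⟨_, rfl⟩ := hp
  obtain ⟨_, rfl⟩ := hq
  rfl

theorem smul (h : IsRep v p) {c : K} (hc : c ≠ 0) : IsRep (c • v) p := by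
  obtain ⟨hv, rfl⟩ := h
  refine ⟨smul_ne_zero hc hv, ?_⟩
  rw [Projectivization.mk_eq_mk_iff']
  exact ⟨c⁻¹, inv_smul_smul₀ hc v⟩

theorem exists_smul (hv : IsRep v p) (hw : IsRep w p) : ∃ c : K, c ≠ 0 ∧ v = c • w := by
  obtain ⟨hv0, rfl⟩ := hv
  obtain ⟨hw0, h⟩ := hw
  obtain ⟨c, rfl⟩ := (Projectivization.mk_eq_mk_iff' K v w hv0 hw0).1 h
  exact ⟨c, left_ne_zero_of_smul hv0, rfl⟩

end IsRep

end Rep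

section Overlap

variable {𝕜 E : Type*} [RCLike 𝕜] [NormedAddCommGroup E] [InnerProductSpace 𝕜 E]
  {u v w : E} {p q r : ℙ 𝕜 E}

local notation "⟪" x ", " y "⟫" => inner 𝕜 x y

theorem IsRep.exists_norm_eq (p : ℙ 𝕜 E) {r : ℝ} (hr : 0 < r) : ∃ v, ‖v‖ = r ∧ IsRep v p := by
  have hp : ‖p.rep‖ ≠ 0 := norm_ne_zero_iff.2 p.rep_nonzero
  have hc : ((r / ‖p.rep‖ : ℝ) : 𝕜) ≠ 0 := RCLike.ofReal_ne_zero.2 (div_ne_zero hr.ne' hp)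
  refine ⟨((r / ‖p.rep‖ : ℝ) : 𝕜) • p.rep, ?_, (IsRep.rep p).smul hc⟩
  rw [norm_smul, RCLike.norm_ofReal, abs_of_nonneg (by positivity), div_mul_cancel₀ _ hp]

/-- The cosine of the angle between two lines, which is also the cosine of their Fubini-Study
distance. Its square is the transition probability of the two corresponding quantum states. -/
noncomputable def overlap (p q : ℙ 𝕜 E) : ℝ := ‖⟪p.rep, q.rep⟫‖ / (‖p.rep‖ * ‖q.rep‖)

theorem IsRep.overlap_eq (hv : IsRep v p) (hw : IsRep w q) :
    overlap p q = ‖⟪v, w⟫‖ / (‖v‖ * ‖w‖) := by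
  obtain ⟨a, ha, rfl⟩ := hv.exists_smul (IsRep.rep p)
  obtain ⟨b, hb, rfl⟩ := hw.exists_smul (IsRep.rep q)
  have ha' := norm_ne_zero_iff.2 ha
  have hb' := norm_ne_zero_iff.2 hb
  rw [overlap, inner_smul_left, inner_smul_right, norm_smul, norm_smul, norm_mul, norm_mul,
    RCLike.norm_conj]
  field_simp

theorem overlap_le_one (p q : ℙ 𝕜 E) : overlap p q ≤ 1 :=
  div_le_one_of_le₀ (norm_inner_le_norm _ _) (by positivity)

theorem overlap_nonneg (p q : ℙ 𝕜 E) : 0 ≤ overlap p q := by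
  unfold overlap; positivity

theorem IsRep.exists_inner_eq_overlap (hu : IsRep u q) (hu1 : ‖u‖ = 1) (p : ℙ 𝕜 E) :
    ∃ v, ‖v‖ = 1 ∧ IsRep v p ∧ ⟪u, v⟫ = overlap p q := by
  obtain ⟨v, hv1, hv⟩ := IsRep.exists_norm_eq p one_pos
  obtain ⟨c, hc, huv⟩ := RCLike.exists_norm_eq_mul_self (⟪u, v⟫)
  have hc0 : c ≠ 0 := norm_ne_zero_iff.1 (by rw [hc]; exact one_ne_zero)
  refine ⟨c • v, by rw [norm_smul, hc, hv1, one_mul], hv.smul hc0, ?_⟩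
  rw [hv.overlap_eq hu, hv1, hu1, mul_one, div_one, inner_smul_right, ← huv, norm_inner_symm]

theorem exists_continuousAt_rep {X : Type*} [TopologicalSpace X] {P : X → ℙ 𝕜 E} {x : X}
    (hP : Filter.Tendsto (fun y => overlap (P y) (P x)) (𝓝 x) (𝓝 1)) :
    ∃ v : X → E, (∀ y, ‖v y‖ = 1) ∧ (∀ y, IsRep (v y) (P y)) ∧ ContinuousAt v x := by
  obtain ⟨u, hu1, hu⟩ := IsRep.exists_norm_eq (P x) one_pos
  choose v hv1 hv huv using fun y => hu.exists_inner_eq_overlap hu1 (P y)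
  have hvx : u = v x := by
    rw [← inner_eq_one_iff_of_norm_eq_one (𝕜 := 𝕜) hu1 (hv1 x), huv, hu.overlap_eq hu,
      norm_inner_eq_norm_iff hu.ne_zero hu.ne_zero |>.2 ⟨1, one_ne_zero, (one_smul 𝕜 u).symm⟩,
      hu1]
    simp
  have hdist (y : X) : ‖v y - v x‖ ^ 2 = 2 - 2 * overlap (P y) (P x) := by
    rw [norm_sub_rev, ← hvx, @norm_sub_sq 𝕜, huv, RCLike.ofReal_re, hu1, hv1]
    ring
  have hlim := (((hP.const_mul 2).const_sub 2).congr fun y => (hdist y).symm).sqrt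
  refine ⟨v, hv1, hv, tendsto_iff_norm_sub_tendsto_zero.2 ?_⟩
  simpa using hlim

/-- The Bargmann invariant of a triangle in projective space. Unlike the pairwise overlaps, it
detects the orientation of the triangle: complex conjugation of the coordinates conjugates it. -/
noncomputable def bargmann (p q r : ℙ 𝕜 E) : 𝕜 :=
  ⟪p.rep, q.rep⟫ * ⟪q.rep, r.rep⟫ * ⟪r.rep, p.rep⟫ /
    ((‖p.rep‖ ^ 2 * ‖q.rep‖ ^ 2 * ‖r.rep‖ ^ 2 : ℝ) : 𝕜)

theorem IsRep.bargmann_eq (hu : IsRep u p) (hv : IsRep v q) (hw : IsRep w r) :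
    bargmann p q r =
      ⟪u, v⟫ * ⟪v, w⟫ * ⟪w, u⟫ / ((‖u‖ ^ 2 * ‖v‖ ^ 2 * ‖w‖ ^ 2 : ℝ) : 𝕜) := by
  obtain ⟨a, ha, rfl⟩ := hu.exists_smul (IsRep.rep p)
  obtain ⟨b, hb, rfl⟩ := hv.exists_smul (IsRep.rep q)
  obtain ⟨c, hc, rfl⟩ := hw.exists_smul (IsRep.rep r)
  have ha' : (starRingEnd 𝕜) a ≠ 0 := by simpa using ha
  have hb' : (starRingEnd 𝕜) b ≠ 0 := by simpa using hb
  have hc' : (starRingEnd 𝕜) c ≠ 0 := by simpa using hc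
  simp only [bargmann, inner_smul_left, inner_smul_right, norm_smul, mul_pow, map_mul, map_pow,
    ← RCLike.mul_conj]
  field_simp

theorem continuous_bargmann {X : Type*} [TopologicalSpace X] {P Q R : X → ℙ 𝕜 E}
    (hP : ∀ x, Filter.Tendsto (fun y => overlap (P y) (P x)) (𝓝 x) (𝓝 1))
    (hQ : ∀ x, Filter.Tendsto (fun y => overlap (Q y) (Q x)) (𝓝 x) (𝓝 1))
    (hR : ∀ x, Filter.Tendsto (fun y => overlap (R y) (R x)) (𝓝 x) (𝓝 1)) :
    Continuous fun x => bargmann (P x) (Q x) (R x) := by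
  refine continuous_iff_continuousAt.2 fun x => ?_
  obtain ⟨u, hu1, hu, hux⟩ := exists_continuousAt_rep (hP x)
  obtain ⟨v, hv1, hv, hvx⟩ := exists_continuousAt_rep (hQ x)
  obtain ⟨w, hw1, hw, hwx⟩ := exists_continuousAt_rep (hR x)
  have hunit : (fun y => bargmann (P y) (Q y) (R y)) =
      fun y => ⟪u y, v y⟫ * ⟪v y, w y⟫ * ⟪w y, u y⟫ := by
    funext y
    rw [(hu y).bargmann_eq (hv y) (hw y), hu1, hv1, hw1]
    simp
  rw [hunit]
  exact ((hux.inner hvx).mul (hvx.inner hwx)).mul (hwx.inner hux)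

end Overlap

/-! ### Wigner's theorem for connected families -/

section Wigner

variable {𝕜 E : Type*} [RCLike 𝕜] [NormedAddCommGroup E] [InnerProductSpace 𝕜 E]
  {ι : Type*} [Fintype ι]

local notation "⟪" x ", " y "⟫" => inner 𝕜 x y

/-- The map `U` on vectors induces the map `T` on lines, as far as the line through `v` is
concerned. -/
def InducesAt (U : E → E) (T : ℙ 𝕜 E → ℙ 𝕜 E) (v : E) : Prop :=
  ∀ p, IsRep v p → IsRep (U v) (T p)

theorem exists_map_norm_inner_eq {T : ℙ 𝕜 E → ℙ 𝕜 E}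
    (hT : ∀ p q, overlap (T p) (T q) = overlap p q) :
    ∃ τ : E → E, (∀ v, InducesAt τ T v) ∧
      ∀ v w, ‖⟪τ v, τ w⟫‖ = ‖⟪v, w⟫‖ := by
  have hex (v : E) : ∃ v', ‖v'‖ = ‖v‖ ∧ ∀ p, IsRep v p → IsRep v' (T p) := by
    rcases eq_or_ne v 0 with rfl | hv
    · exact ⟨0, rfl, fun p hp => absurd rfl hp.ne_zero⟩
    · obtain ⟨v', hv', hrep⟩ :=
        IsRep.exists_norm_eq (T (Projectivization.mk 𝕜 v hv)) (norm_pos_iff.2 hv)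
      exact ⟨v', hv', fun p hp => (IsRep.mk hv).unique hp ▸ hrep⟩
  choose τ hnorm hτ using hex
  refine ⟨τ, hτ, fun v w => ?_⟩
  rcases eq_or_ne v 0 with rfl | hv
  · simp [norm_eq_zero.1 ((hnorm 0).trans norm_zero)]
  rcases eq_or_ne w 0 with rfl | hw
  · simp [norm_eq_zero.1 ((hnorm 0).trans norm_zero)]
  have h := hT (Projectivization.mk 𝕜 v hv) (Projectivization.mk 𝕜 w hw)
  rw [(hτ v _ (IsRep.mk hv)).overlap_eq (hτ w _ (IsRep.mk hw)),
    (IsRep.mk hv).overlap_eq (IsRep.mk hw), hnorm, hnorm] at h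
  have := norm_ne_zero_iff.2 hv
  have := norm_ne_zero_iff.2 hw
  field_simp at h
  exact h

theorem norm_map_eq_of_norm_inner_eq {τ : E → E} (hτ : ∀ v w, ‖⟪τ v, τ w⟫‖ = ‖⟪v, w⟫‖) (v : E) :
    ‖τ v‖ = ‖v‖ := by
  have h := hτ v v
  rw [inner_self_eq_norm_sq_to_K, inner_self_eq_norm_sq_to_K, norm_pow, norm_pow,
    RCLike.norm_ofReal, RCLike.norm_ofReal, abs_norm, abs_norm] at h
  exact (sq_eq_sq₀ (norm_nonneg _) (norm_nonneg _)).1 h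

theorem exists_eq_smul_of_norm_inner_eq {v w : E} (hnorm : ‖v‖ = ‖w‖)
    (h : ‖⟪v, w⟫‖ = ‖v‖ * ‖w‖) : ∃ c : 𝕜, ‖c‖ = 1 ∧ v = c • w := by
  rcases eq_or_ne v 0 with rfl | hv
  · exact ⟨1, norm_one, by rw [norm_eq_zero.1 (hnorm.symm.trans norm_zero), smul_zero]⟩
  have hw : w ≠ 0 := norm_ne_zero_iff.1 (hnorm ▸ norm_ne_zero_iff.2 hv)
  obtain ⟨c, -, rfl⟩ := (norm_inner_eq_norm_iff (𝕜 := 𝕜) hw hv).1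
    (by rw [norm_inner_symm, h, mul_comm])
  refine ⟨c, ?_, rfl⟩
  rw [norm_smul] at hnorm
  exact (mul_eq_right₀ (norm_ne_zero_iff.2 hw)).1 hnorm

theorem exists_smul_add_eq_of_norm_inner_eq {τ : E → E}
    (hτ : ∀ v w, ‖⟪τ v, τ w⟫‖ = ‖⟪v, w⟫‖) {v w : E} (hv : ‖v‖ = 1) (hw : ‖w‖ = 1)
    (hvw : ⟪v, w⟫ = 0) :
    ∃ c d : 𝕜, ‖c‖ = 1 ∧ ‖d‖ = 1 ∧ τ v + c • τ w = d • τ (v + w) := by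
  have hnorm := norm_map_eq_of_norm_inner_eq hτ
  have hsum : ‖v + w‖ ^ 2 = 2 := by
    rw [@norm_add_sq 𝕜, hvw, hv, hw, map_zero]
    norm_num
  have hτvw : ⟪τ v, τ w⟫ = 0 := norm_eq_zero.1 (by rw [hτ, hvw, norm_zero])
  have hinner_v : ‖⟪τ v, τ (v + w)⟫‖ = 1 := by
    rw [hτ, inner_add_right, hvw, inner_self_eq_one_of_norm_eq_one hv, add_zero, norm_one]
  have hinner_w : ‖⟪τ (v + w), τ w⟫‖ = 1 := by
    rw [hτ, inner_add_left, hvw, inner_self_eq_one_of_norm_eq_one hw, zero_add, norm_one]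
  obtain ⟨d, hd, hdv⟩ := RCLike.exists_norm_eq_mul_self (⟪τ v, τ (v + w)⟫)
  have hf1 : ‖d • τ (v + w) - τ v‖ = 1 := by
    refine (sq_eq_sq₀ (norm_nonneg _) one_pos.le).1 ?_
    rw [norm_sub_rev, @norm_sub_sq 𝕜, inner_smul_right, ← hdv, hinner_v, norm_smul, hd, hnorm,
      hnorm, hv, one_mul, hsum]
    norm_num
  have hfw : ‖⟪d • τ (v + w) - τ v, τ w⟫‖ = 1 := by
    rw [inner_sub_left, hτvw, sub_zero, inner_smul_left, norm_mul, RCLike.norm_conj, hd, hinner_w,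
      one_mul]
  have hτw : ‖τ w‖ = 1 := (hnorm w).trans hw
  obtain ⟨c, hc, hcw⟩ := exists_eq_smul_of_norm_inner_eq (𝕜 := 𝕜) (hf1.trans hτw.symm)
    (by rw [hfw, hf1, hτw, one_mul])
  exact ⟨c, d, hc, hd, by rw [← hcw, add_sub_cancel]⟩

theorem exists_linearIsometryEquiv_map_basis {T : ℙ 𝕜 E → ℙ 𝕜 E}
    (hT : ∀ p q, overlap (T p) (T q) = overlap p q) (e : OrthonormalBasis ι 𝕜 E) (i : ι) :
    ∃ U : E ≃ₗᵢ[𝕜] E, (∀ k, InducesAt U T (e k)) ∧ ∀ k ≠ i, InducesAt U T (e i + e k) := by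
  obtain ⟨τ, hτT, hτ⟩ := exists_map_norm_inner_eq hT
  have he := e.orthonormal
  have hphase (k : ι) : ∃ c : 𝕜, ‖c‖ = 1 ∧ (k = i → c = 1) ∧
      (k ≠ i → ∃ d : 𝕜, ‖d‖ = 1 ∧ τ (e i) + c • τ (e k) = d • τ (e i + e k)) := by
    rcases eq_or_ne k i with rfl | hk
    · exact ⟨1, norm_one, fun _ => rfl, fun h => absurd rfl h⟩
    · obtain ⟨c, d, hc, hd, hcd⟩ :=
        exists_smul_add_eq_of_norm_inner_eq hτ (he.1 i) (he.1 k) (he.2 hk.symm)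
      exact ⟨c, hc, fun h => absurd h hk, fun _ => ⟨d, hd, hcd⟩⟩
  choose c hc hci hcd using hphase
  have hf : Orthonormal 𝕜 fun k => c k • τ (e k) := by
    refine ⟨fun k => ?_, fun j k hjk => ?_⟩
    · rw [norm_smul, hc, one_mul, norm_map_eq_of_norm_inner_eq hτ, he.1]
    · have h0 : ⟪τ (e j), τ (e k)⟫ = 0 := norm_eq_zero.1 (by rw [hτ, he.2 hjk, norm_zero])
      simp only [inner_smul_left, inner_smul_right, h0, mul_zero]
  have : FiniteDimensional 𝕜 E := e.toBasis.finiteDimensional_of_finite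
  let f : OrthonormalBasis ι 𝕜 E := OrthonormalBasis.mk hf
    (hf.linearIndependent.span_eq_top_of_card_eq_finrank'
      (Module.finrank_eq_card_basis e.toBasis).symm).ge
  have hU (k : ι) : e.equiv f (Equiv.refl ι) (e k) = c k • τ (e k) := by
    simp [f]
  have hne {c : 𝕜} (hc : ‖c‖ = 1) : c ≠ 0 := norm_ne_zero_iff.1 (hc ▸ one_ne_zero)
  refine ⟨e.equiv f (Equiv.refl ι), fun k p hp => ?_, fun k hk p hp => ?_⟩
  · rw [hU]
    exact (hτT _ p hp).smul (hne (hc k))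
  · obtain ⟨d, hd, hcd⟩ := hcd k hk
    rw [map_add, hU, hU, hci i rfl, one_smul, hcd]
    exact (hτT _ p hp).smul (hne hd)

theorem eq_or_eq_conj_of_norm_eq {a b : 𝕜} (h : ‖a‖ = ‖b‖) (h1 : ‖1 + a‖ = ‖1 + b‖) :
    a = b ∨ a = (starRingEnd 𝕜) b := by
  have hsq : RCLike.re a * RCLike.re a + RCLike.im a * RCLike.im a =
      RCLike.re b * RCLike.re b + RCLike.im b * RCLike.im b := by
    rw [← RCLike.norm_sq_eq_def, ← RCLike.norm_sq_eq_def, h]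
  have hre : RCLike.re a = RCLike.re b := by
    have hsq1 : ‖1 + a‖ ^ 2 = ‖1 + b‖ ^ 2 := by rw [h1]
    rw [RCLike.norm_sq_eq_def, RCLike.norm_sq_eq_def] at hsq1
    simp only [map_add, RCLike.one_re, RCLike.one_im] at hsq1
    linarith
  rw [hre, add_right_inj] at hsq
  refine (mul_self_eq_mul_self_iff.1 hsq).imp (RCLike.ext hre) fun him => RCLike.ext ?_ ?_
  · rw [RCLike.conj_re, hre]
  · rw [RCLike.conj_im, him]

theorem InducesAt.norm_inner_eq {T : ℙ 𝕜 E → ℙ 𝕜 E}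
    (hT : ∀ p q, overlap (T p) (T q) = overlap p q) {U : E →ₗᵢ[𝕜] E} {u v v' : E} {p : ℙ 𝕜 E}
    (hu : InducesAt U T u) (hv : IsRep v p) (hv' : IsRep v' (T p)) (hnorm : ‖v'‖ = ‖v‖) :
    ‖⟪U u, v'⟫‖ = ‖⟪u, v⟫‖ := by
  rcases eq_or_ne u 0 with rfl | hu0
  · simp
  have h := hT (Projectivization.mk 𝕜 u hu0) p
  have := norm_ne_zero_iff.2 hu0
  have := norm_ne_zero_iff.2 hv.ne_zero
  rw [(hu _ (IsRep.mk hu0)).overlap_eq hv', (IsRep.mk hu0).overlap_eq hv, U.norm_map, hnorm] at h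
  field_simp at h
  exact h

theorem exists_normalized_preimage {T : ℙ 𝕜 E → ℙ 𝕜 E}
    (hT : ∀ p q, overlap (T p) (T q) = overlap p q) {e : OrthonormalBasis ι 𝕜 E} {i : ι}
    {U : E ≃ₗᵢ[𝕜] E} (hU : ∀ k, InducesAt U T (e k)) (hU' : ∀ k ≠ i, InducesAt U T (e i + e k))
    {v : E} {p : ℙ 𝕜 E} (hp : IsRep v p) (hv : ⟪e i, v⟫ = 1) :
    ∃ w, ‖w‖ = ‖v‖ ∧ IsRep (U w) (T p) ∧ ⟪e i, w⟫ = 1 ∧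
      ∀ k ≠ i, ⟪e k, w⟫ = ⟪e k, v⟫ ∨ ⟪e k, w⟫ = (starRingEnd 𝕜) ⟪e k, v⟫ := by
  obtain ⟨v', hv', hrep⟩ := IsRep.exists_norm_eq (T p) (norm_pos_iff.2 hp.ne_zero)
  have hinner {b : E} (hb : InducesAt U T b) : ‖⟪b, U.symm v'⟫‖ = ‖⟪b, v⟫‖ := by
    rw [← U.inner_map_map, U.apply_symm_apply]
    exact hb.norm_inner_eq (U := U.toLinearIsometry) hT hp hrep hv'
  obtain ⟨c, hc, hci⟩ := RCLike.exists_norm_eq_mul_self (⟪e i, U.symm v'⟫)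
  have hi : ⟪e i, c • U.symm v'⟫ = 1 := by
    rw [inner_smul_right, ← hci, hinner (hU i), hv, norm_one, RCLike.ofReal_one]
  refine ⟨c • U.symm v', ?_, ?_, hi, fun k hk => eq_or_eq_conj_of_norm_eq ?_ ?_⟩
  · rw [norm_smul, hc, one_mul, U.symm.norm_map, hv']
  · rw [map_smul, U.apply_symm_apply]
    exact hrep.smul (norm_ne_zero_iff.1 (hc ▸ one_ne_zero))
  · rw [inner_smul_right, norm_mul, hc, one_mul, hinner (hU k)]
  · rw [← hi, ← inner_add_left, inner_smul_right, norm_mul, hc, one_mul, hinner (hU' k hk),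
      inner_add_left, hv, hi]

theorem bargmann_basis (e : OrthonormalBasis ι 𝕜 E) {i k : ι} (hk : k ≠ i)
    {p q r : ℙ 𝕜 E} {U : E ≃ₗᵢ[𝕜] E} {w : E} (hp : IsRep (U (e i)) p)
    (hq : IsRep (U (e i + e k)) q) (hr : IsRep (U w) r) (hw : ⟪e i, w⟫ = 1) :
    bargmann p q r = (1 + ⟪e k, w⟫) / ((2 * ‖w‖ ^ 2 : ℝ) : 𝕜) := by
  have he := e.orthonormal
  have hsum : ‖e i + e k‖ ^ 2 = 2 := by
    rw [@norm_add_sq 𝕜, he.2 hk.symm, he.1, he.1, map_zero]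
    norm_num
  have hw' : ⟪w, e i⟫ = 1 := by rw [← inner_conj_symm, hw, map_one]
  rw [hp.bargmann_eq hq hr, U.inner_map_map, U.inner_map_map, U.inner_map_map, U.norm_map,
    U.norm_map, U.norm_map, hsum, inner_add_right, inner_add_left, hw, hw', he.2 hk.symm,
    inner_self_eq_one_of_norm_eq_one (he.1 i)]
  simp

variable {X : Type*} [TopologicalSpace X] [PreconnectedSpace X] {T : X → ℙ 𝕜 E → ℙ 𝕜 E} {x₀ : X}

/-- The overlaps alone determine a coordinate only up to complex conjugation. The Bargmann invariant
distinguishes the two cases, and by connectedness it cannot jump. -/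
theorem inducesAt_of_inner_eq_one (hT : ∀ x p q, overlap (T x p) (T x q) = overlap p q)
    (hcont : ∀ p x, Filter.Tendsto (fun y => overlap (T y p) (T x p)) (𝓝 x) (𝓝 1))
    (hx₀ : T x₀ = id) {e : OrthonormalBasis ι 𝕜 E} {i : ι} {U : X → E ≃ₗᵢ[𝕜] E}
    (hU : ∀ x k, InducesAt (U x) (T x) (e k))
    (hU' : ∀ x, ∀ k ≠ i, InducesAt (U x) (T x) (e i + e k)) {v : E} (hv : ⟪e i, v⟫ = 1) (x : X) :
    InducesAt (U x) (T x) v := by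
  intro p hp
  choose w hnorm hrep hwi hwk using fun y => exists_normalized_preimage (hT y) (hU y) (hU' y) hp hv
  suffices hw : w x = v from hw ▸ hrep x
  refine e.repr.injective (PiLp.ext fun k => ?_)
  rw [e.repr_apply_apply, e.repr_apply_apply]
  rcases eq_or_ne k i with rfl | hk
  · rw [hwi, hv]
  have hi := IsRep.mk (K := 𝕜) (e.orthonormal.ne_zero i)
  have hik : e i + e k ≠ 0 := fun h0 => by
    have := congrArg (fun u => ⟪e i, u⟫) h0
    simp [inner_add_right, e.orthonormal.2 hk.symm] at this
  set B : X → 𝕜 := fun y => bargmann (T y (Projectivization.mk 𝕜 _ hi.ne_zero))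
    (T y (Projectivization.mk 𝕜 _ hik)) (T y p) with hB
  have hBw (y : X) : B y = (1 + ⟪e k, w y⟫) / ((2 * ‖v‖ ^ 2 : ℝ) : 𝕜) := by
    rw [← hnorm y]
    exact bargmann_basis e hk (hU y i _ hi) (hU' y k hk _ (IsRep.mk hik)) (hrep y) (hwi y)
  have hBv : B x₀ = (1 + ⟪e k, v⟫) / ((2 * ‖v‖ ^ 2 : ℝ) : 𝕜) := by
    simp only [hB, hx₀, id]
    exact bargmann_basis (U := LinearIsometryEquiv.refl 𝕜 E) e hk hi (IsRep.mk hik) hp hv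
  have hfinite : (Set.range B).Finite := by
    refine (Set.toFinite {(1 + ⟪e k, v⟫) / ((2 * ‖v‖ ^ 2 : ℝ) : 𝕜),
      (1 + (starRingEnd 𝕜) ⟪e k, v⟫) / ((2 * ‖v‖ ^ 2 : ℝ) : 𝕜)}).subset ?_
    rintro _ ⟨y, rfl⟩
    rw [hBw]
    rcases hwk y k hk with h | h <;> simp [h]
  have hconst : B x = B x₀ :=
    hfinite.countable.isTotallyDisconnected _ subset_rfl
      (isPreconnected_range (continuous_bargmann (hcont _) (hcont _) (hcont _)))
      (Set.mem_range_self x) (Set.mem_range_self x₀)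
  have := norm_pos_iff.2 hp.ne_zero
  have hne : ((2 * ‖v‖ ^ 2 : ℝ) : 𝕜) ≠ 0 := RCLike.ofReal_ne_zero.2 (by positivity)
  rwa [hBw, hBv, div_left_inj' hne, add_right_inj] at hconst

theorem InducesAt.of_forall_inner_ne_zero [CompleteSpace E] {T : ℙ 𝕜 E → ℙ 𝕜 E}
    (hT : ∀ p q, overlap (T p) (T q) = overlap p q) {U : E →ₗᵢ[𝕜] E} {a : E} (ha : a ≠ 0)
    (hU : ∀ v, ⟪a, v⟫ ≠ 0 → InducesAt U T v) (v : E) : InducesAt U T v := by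
  intro p hp
  obtain ⟨v', hv', hrep⟩ := IsRep.exists_norm_eq (T p) (norm_pos_iff.2 hp.ne_zero)
  have hdense : Dense {u | ⟪a, u⟫ ≠ 0} := by
    have hsurj : Function.Surjective (innerSL 𝕜 a) :=
      (innerSL 𝕜 a).toLinearMap.surjective fun h0 => ha <| by
        simpa using LinearMap.congr_fun h0 a
    exact (dense_compl_singleton (0 : 𝕜)).preimage ((innerSL 𝕜 a).isOpenMap hsurj)
  have hinner : (fun u => ‖⟪U u, v'⟫‖) = fun u => ‖⟪u, v⟫‖ :=
    Continuous.ext_on hdense (U.continuous.inner continuous_const).norm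
      (continuous_id.inner continuous_const).norm
      fun u hu => (hU u hu).norm_inner_eq hT hp hrep hv'
  have hUv : ‖⟪U v, v'⟫‖ = ‖U v‖ * ‖v'‖ := by
    rw [congrFun hinner v, inner_self_eq_norm_sq_to_K, norm_pow, RCLike.norm_ofReal, abs_norm,
      U.norm_map, hv', sq]
  obtain ⟨c, hc, hcv⟩ :=
    exists_eq_smul_of_norm_inner_eq ((U.norm_map v).trans hv'.symm) hUv
  rw [hcv]
  exact hrep.smul (norm_ne_zero_iff.1 (hc ▸ one_ne_zero))

theorem exists_linearIsometryEquiv_inducesAt [FiniteDimensional 𝕜 E]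
    (hT : ∀ x p q, overlap (T x p) (T x q) = overlap p q)
    (hcont : ∀ p x, Filter.Tendsto (fun y => overlap (T y p) (T x p)) (𝓝 x) (𝓝 1))
    (hx₀ : T x₀ = id) (x : X) : ∃ U : E ≃ₗᵢ[𝕜] E, ∀ v, InducesAt U (T x) v := by
  rcases subsingleton_or_nontrivial E with hE | hE
  · exact ⟨LinearIsometryEquiv.refl 𝕜 E, fun v p hp => absurd (Subsingleton.elim v 0) hp.ne_zero⟩
  have : CompleteSpace E := FiniteDimensional.complete 𝕜 E
  let e := stdOrthonormalBasis 𝕜 E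
  let i : Fin (Module.finrank 𝕜 E) := ⟨0, Module.finrank_pos⟩
  choose U hU hU' using fun y => exists_linearIsometryEquiv_map_basis (hT y) e i
  refine ⟨U x, InducesAt.of_forall_inner_ne_zero (U := (U x).toLinearIsometry) (hT x)
    (e.orthonormal.ne_zero i) fun v hv p hp => ?_⟩
  have hnormalized := inducesAt_of_inner_eq_one hT hcont hx₀ hU hU'
    (v := (⟪e i, v⟫)⁻¹ • v) (by rw [inner_smul_right, inv_mul_cancel₀ hv]) x p
    (hp.smul (inv_ne_zero hv))
  rw [map_smul] at hnormalized
  simpa [smul_inv_smul₀ hv] using hnormalized.smul hv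

end Wigner

/-! ### The conjugate cross product and special unitary maps -/

local notation "⟪" x ", " y "⟫" => inner ℂ x y

section ConjCross

variable {a b c : C3}

/-- The complex conjugate of the cross product, characterized by `⟪a × b, c⟫ = det (a, b, c)`. It
is orthogonal to both factors, and equivariant under `SU(3)`. -/
noncomputable def conjCross (a b : C3) : C3 := WithLp.toLp 2 (star (crossProduct a.ofLp b.ofLp))

theorem conjCross_apply (a b : C3) :
    conjCross a b = WithLp.toLp 2 ![star (a 1 * b 2 - a 2 * b 1), star (a 2 * b 0 - a 0 * b 2),
      star (a 0 * b 1 - a 1 * b 0)] := by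
  ext i
  fin_cases i <;> simp [conjCross, cross_apply]

theorem inner_C3 (a b : C3) :
    ⟪a, b⟫ = star (a 0) * b 0 + star (a 1) * b 1 + star (a 2) * b 2 := by
  simp [PiLp.inner_apply, Fin.sum_univ_three, mul_comm]

theorem conjCross_add_left (a b c : C3) :
    conjCross (a + b) c = conjCross a c + conjCross b c := by
  simp [conjCross]

theorem conjCross_add_right (a b c : C3) :
    conjCross a (b + c) = conjCross a b + conjCross a c := by
  simp [conjCross]

theorem conjCross_sub_right (a b c : C3) :
    conjCross a (b - c) = conjCross a b - conjCross a c := by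
  simp [conjCross]

theorem conjCross_zero_right (a : C3) : conjCross a 0 = 0 := by
  simp [conjCross]

theorem conjCross_smul_left (k : ℂ) (a b : C3) : conjCross (k • a) b = star k • conjCross a b := by
  simp [conjCross]

theorem conjCross_smul_right (k : ℂ) (a b : C3) :
    conjCross a (k • b) = star k • conjCross a b := by
  simp [conjCross]

theorem conjCross_swap (a b : C3) : conjCross b a = -conjCross a b := by
  rw [conjCross, ← cross_anticomm, star_neg, WithLp.toLp_neg, conjCross]

theorem conjCross_self (a : C3) : conjCross a a = 0 := by
  simp [conjCross]

theorem inner_conjCross_eq_det (a b c : C3) :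
    ⟪conjCross a b, c⟫ = (EuclideanSpace.basisFun (Fin 3) ℂ).toBasis.det ![a, b, c] := by
  rw [Module.Basis.det_apply, Matrix.det_fin_three, inner_C3, conjCross_apply]
  simp [Module.Basis.toMatrix_apply]
  ring

theorem inner_left_conjCross (a b : C3) : ⟪a, conjCross a b⟫ = 0 := by
  rw [inner_C3, conjCross_apply]
  simp
  ring

theorem inner_right_conjCross (a b : C3) : ⟪b, conjCross a b⟫ = 0 := by
  rw [conjCross_swap, inner_neg_right, inner_left_conjCross, neg_zero]

theorem conjCross_conjCross (a b c : C3) :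
    conjCross a (conjCross b c) = ⟪a, c⟫ • b - ⟪a, b⟫ • c := by
  rw [conjCross_apply, conjCross_apply, inner_C3, inner_C3]
  ext i
  fin_cases i <;> simp <;> ring

theorem inner_conjCross_conjCross (a b c d : C3) :
    ⟪conjCross a b, conjCross c d⟫ = ⟪c, a⟫ * ⟪d, b⟫ - ⟪c, b⟫ * ⟪d, a⟫ := by
  simp only [inner_C3, conjCross_apply]
  simp
  ring

theorem norm_conjCross_of_inner_eq_zero (hab : ⟪a, b⟫ = 0) : ‖conjCross a b‖ = ‖a‖ * ‖b‖ := by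
  have h := inner_conjCross_conjCross a b a b
  rw [hab, inner_self_eq_norm_sq_to_K, inner_self_eq_norm_sq_to_K, inner_self_eq_norm_sq_to_K,
    zero_mul, sub_zero, ← mul_pow] at h
  exact (sq_eq_sq₀ (norm_nonneg _) (by positivity)).1 (by exact_mod_cast h)

/-- The expansion of `v` in the basis `a`, `b`, `a × b`, multiplied by the Gram determinant. -/
theorem inner_conjCross_self_smul (a b v : C3) :
    ⟪conjCross a b, conjCross a b⟫ • v = ⟪conjCross a b, v⟫ • conjCross a b
      + (⟪a, v⟫ * ⟪b, b⟫ - ⟪b, v⟫ * ⟪a, b⟫) • a + (⟪b, v⟫ * ⟪a, a⟫ - ⟪a, v⟫ * ⟪b, a⟫) • b := by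
  set n := conjCross a b
  have hv : conjCross n (conjCross n v) = ⟪n, v⟫ • n - ⟪n, n⟫ • v := conjCross_conjCross n n v
  have hnv : conjCross n v = ⟪v, a⟫ • b - ⟪v, b⟫ • a := by
    rw [conjCross_swap, conjCross_conjCross, neg_sub]
  have hna : conjCross n a = ⟪a, a⟫ • b - ⟪a, b⟫ • a := by
    rw [conjCross_swap, conjCross_conjCross, neg_sub]
  have hnb : conjCross n b = ⟪b, a⟫ • b - ⟪b, b⟫ • a := by
    rw [conjCross_swap, conjCross_conjCross, neg_sub]
  rw [hnv, sub_eq_add_neg, ← neg_smul, conjCross_add_right, conjCross_smul_right,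
    conjCross_smul_right, hna, hnb, star_neg, RCLike.star_def, inner_conj_symm,
    inner_conj_symm] at hv
  rw [eq_sub_iff_add_eq, ← eq_sub_iff_add_eq'] at hv
  rw [hv]
  module

theorem conjCross_real_smul_left (k : ℝ) (a b : C3) :
    conjCross (k • a) b = k • conjCross a b := by
  simp [conjCross]

theorem conjCross_real_smul_right (k : ℝ) (a b : C3) :
    conjCross a (k • b) = k • conjCross a b := by
  simp [conjCross]

/-- The conjugate cross product as a continuous real bilinear map. -/
noncomputable def conjCrossL : C3 →L[ℝ] C3 →L[ℝ] C3 :=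
  (LinearMap.mk₂ ℝ conjCross conjCross_add_left conjCross_real_smul_left conjCross_add_right
    conjCross_real_smul_right).toContinuousBilinearMap

/-- Membership in `SU(3)`. A unitary map `U` satisfies `U a × U b = conj (det U) • U (a × b)`, so
that compatibility with the conjugate cross product encodes `det U = 1`. -/
structure IsSU (U : C3 →L[ℂ] C3) : Prop where
  inner_map : ∀ a b, ⟪U a, U b⟫ = ⟪a, b⟫
  map_conjCross : ∀ a b, U (conjCross a b) = conjCross (U a) (U b)

namespace IsSU

variable {U : C3 →L[ℂ] C3}

theorem norm_map (hU : IsSU U) (a : C3) : ‖U a‖ = ‖a‖ := by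
  rw [@norm_eq_sqrt_re_inner ℂ, @norm_eq_sqrt_re_inner ℂ, hU.inner_map]

theorem map_ne_zero (hU : IsSU U) (ha : a ≠ 0) : U a ≠ 0 := by
  rw [← norm_ne_zero_iff, hU.norm_map]
  exact norm_ne_zero_iff.2 ha

theorem smul (hU : IsSU U) {k : ℂ} (hk3 : k ^ 3 = 1) : IsSU (k • U) := by
  have hkk : star k * k = 1 := by
    rw [RCLike.star_def, Complex.conj_mul', Complex.norm_eq_one_of_pow_eq_one hk3 three_ne_zero]
    simp
  refine ⟨fun a b => ?_, fun a b => ?_⟩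
  · rw [smul_apply, smul_apply, inner_smul_left, inner_smul_right, hU.inner_map, ← mul_assoc,
      ← RCLike.star_def, hkk, one_mul]
  · rw [smul_apply, smul_apply, smul_apply, hU.map_conjCross, conjCross_smul_left,
      conjCross_smul_right, smul_smul]
    congr 1
    linear_combination star k ^ 2 * hk3 - k * (k * star k + 1) * hkk

end IsSU

theorem conjCross_map_eq_smul (U : C3 ≃ₗᵢ[ℂ] C3) (a b : C3) :
    conjCross (U a) (U b) = star (LinearMap.det (U.toLinearEquiv : C3 →ₗ[ℂ] C3)) •
      U (conjCross a b) := by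
  refine ext_inner_right ℂ fun v => ?_
  obtain ⟨c, rfl⟩ := U.surjective v
  have hcomp : ![U a, U b, U c] = (U.toLinearEquiv : C3 →ₗ[ℂ] C3) ∘ ![a, b, c] := by
    ext i
    fin_cases i <;> rfl
  rw [inner_conjCross_eq_det, hcomp, Module.Basis.det_comp, ← inner_conjCross_eq_det,
    inner_smul_left, ← RCLike.star_def, star_star, U.inner_map_map]

theorem exists_smul_isSU (U : C3 ≃ₗᵢ[ℂ] C3) :
    ∃ μ : ℂ, μ ≠ 0 ∧ IsSU (μ • (U.toContinuousLinearEquiv : C3 →L[ℂ] C3)) := by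
  set d := LinearMap.det (U.toLinearEquiv : C3 →ₗ[ℂ] C3) with hd
  have hd1 : ‖d‖ = 1 := by
    rw [hd, ← LinearMap.normDet_eq_norm_det]
    exact U.toLinearIsometry.normDet_eq_one
  obtain ⟨μ, hμ⟩ := IsAlgClosed.exists_pow_nat_eq (star d) three_pos
  have hμ1 : ‖μ‖ = 1 := by
    refine (pow_eq_one_iff_of_nonneg (norm_nonneg _) three_ne_zero).1 ?_
    rw [← norm_pow, hμ, norm_star, hd1]
  have hμμ : star μ * μ = 1 := by rw [RCLike.star_def, Complex.conj_mul', hμ1]; simp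
  refine ⟨μ, norm_ne_zero_iff.1 (hμ1 ▸ one_ne_zero), fun a b => ?_, fun a b => ?_⟩
  · change ⟪μ • U a, μ • U b⟫ = ⟪a, b⟫
    rw [inner_smul_left, inner_smul_right, U.inner_map_map, ← mul_assoc, ← RCLike.star_def, hμμ,
      one_mul]
  · change μ • U (conjCross a b) = conjCross (μ • U a) (μ • U b)
    rw [conjCross_smul_left, conjCross_smul_right, conjCross_map_eq_smul, ← hd, ← hμ, smul_smul,
      smul_smul]
    congr 1
    linear_combination (-μ) * (star μ * μ + 1) * hμμ

end ConjCross

namespace IsOneParameterIsometryGroup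

variable {R : ℝ → Equiv.Perm CP2}

theorem map_zero (hR : IsOneParameterIsometryGroup R) : R 0 = 1 := by
  have h := hR.add 0 0
  rwa [add_zero, left_eq_mul] at h

theorem exists_isSU (hR : IsOneParameterIsometryGroup R) (t : ℝ) :
    ∃ U, IsSU U ∧ ∀ v, InducesAt U (R t) v := by
  have hcos (p q : CP2) : Real.cos (fsDist p q) = overlap p q :=
    Real.cos_arccos ((neg_one_lt_zero.le).trans (overlap_nonneg p q)) (overlap_le_one p q)
  obtain ⟨U, hU⟩ := exists_linearIsometryEquiv_inducesAt (T := fun t => R t) (x₀ := 0)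
    (fun t p q => by rw [← hcos, ← hcos, hR.isometry])
    (fun p s => by
      simpa [Function.comp_def, hcos] using
        (Real.continuous_cos.tendsto 0).comp (hR.continuous p s))
    (by rw [hR.map_zero]; rfl) t
  obtain ⟨μ, hμ, hμU⟩ := exists_smul_isSU U
  exact ⟨_, hμU, fun v p hp => (hU v p hp).smul hμ⟩

end IsOneParameterIsometryGroup

/-! ### Calculus of lifts -/

section Calculus

variable {E F : Type*} [NormedAddCommGroup E] [NormedSpace ℝ E] [NormedAddCommGroup F]
  [NormedSpace ℝ F] {f : E → F} {s : Set E} {x : E}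

theorem differentiableAt_of_contDiffOn (hs : IsOpen s) (hf : ContDiffOn ℝ ∞ f s) (hx : x ∈ s) :
    DifferentiableAt ℝ f x :=
  (hf.contDiffAt (hs.mem_nhds hx)).differentiableAt (by simp)

theorem contDiffOn_fderiv_apply (hs : IsOpen s) (hf : ContDiffOn ℝ ∞ f s) (v : E) :
    ContDiffOn ℝ ∞ (fun x => fderiv ℝ f x v) s :=
  (hf.fderiv_of_isOpen hs (by simp)).clm_apply contDiffOn_const

theorem fderiv_fderiv_apply_comm (hs : IsOpen s) (hf : ContDiffOn ℝ ∞ f s) (hx : x ∈ s) (v w : E) :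
    fderiv ℝ (fun x => fderiv ℝ f x w) x v = fderiv ℝ (fun x => fderiv ℝ f x v) x w := by
  have hd : DifferentiableAt ℝ (fderiv ℝ f) x :=
    differentiableAt_of_contDiffOn hs (hf.fderiv_of_isOpen hs (by simp)) hx
  have hsymm : IsSymmSndFDerivAt ℝ f x :=
    (hf.contDiffAt (hs.mem_nhds hx)).isSymmSndFDerivAt
      (by simpa using WithTop.coe_le_coe.2 (le_top : (2 : ℕ∞) ≤ ⊤))
  have happly (v w : E) :
      fderiv ℝ (fun x => fderiv ℝ f x w) x v = fderiv ℝ (fderiv ℝ f) x v w := by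
    rw [fderiv_clm_apply hd (differentiableAt_const w)]
    simp
  rw [happly, happly]
  exact hsymm v w

theorem fderiv_complex_smul_apply [NormedSpace ℂ F] {l : E → ℂ}
    (hl : DifferentiableAt ℝ l x) (hf : DifferentiableAt ℝ f x) (v : E) :
    fderiv ℝ (fun x => l x • f x) x v = l x • fderiv ℝ f x v + fderiv ℝ l x v • f x := by
  rw [fderiv_fun_smul hl hf]
  rfl

theorem contDiffOn_conjCross {a b : E → C3} (ha : ContDiffOn ℝ ∞ a s) (hb : ContDiffOn ℝ ∞ b s) :
    ContDiffOn ℝ ∞ (fun x => conjCross (a x) (b x)) s :=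
  (conjCrossL.contDiff.comp_contDiffOn ha).clm_apply hb

theorem fderiv_conjCross {a b : E → C3} (ha : DifferentiableAt ℝ a x) (hb : DifferentiableAt ℝ b x)
    (v : E) : fderiv ℝ (fun x => conjCross (a x) (b x)) x v =
      conjCross (a x) (fderiv ℝ b x v) + conjCross (fderiv ℝ a x v) (b x) :=
  congrArg (· v) (conjCrossL.hasFDerivAt_of_bilinear ha.hasFDerivAt hb.hasFDerivAt).fderiv

theorem exists_contDiffOn_pow_eq {g : E → ℂ} {p : E} {n : WithTop ℕ∞} {k : ℕ} (hk : k ≠ 0)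
    (hs : IsOpen s) (hg : ContDiffOn ℝ n g s) (hp : p ∈ s) (hgp : g p ≠ 0) :
    ∃ t ⊆ s, IsOpen t ∧ p ∈ t ∧ ∃ l, ContDiffOn ℝ n l t ∧ ∀ x ∈ t, l x ^ k = g x := by
  obtain ⟨μ, hμ⟩ := IsAlgClosed.exists_pow_nat_eq (g p) (Nat.pos_of_ne_zero hk)
  refine ⟨s ∩ (fun x => g x / g p) ⁻¹' Complex.slitPlane, Set.inter_subset_left,
    (hg.continuousOn.div_const _).isOpen_inter_preimage hs Complex.isOpen_slitPlane,
    ⟨hp, by simp [div_self hgp]⟩, fun x => μ * Complex.exp (Complex.log (g x / g p) / k),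
    contDiffOn_const.mul (Complex.contDiff_exp.comp_contDiffOn (ContDiffOn.div_const ?_ _)),
    fun x hx => ?_⟩
  · exact fun x hx => ContDiffAt.comp_contDiffWithinAt x (g := Complex.log)
      ((Complex.contDiffAt_log hx.2).restrict_scalars ℝ)
      (((hg.mono Set.inter_subset_left).div_const _) x hx)
  · rw [mul_pow, ← Complex.exp_nat_mul, mul_div_cancel₀ _ (Nat.cast_ne_zero.2 hk),
      Complex.exp_log (Complex.slitPlane_ne_zero hx.2), hμ, mul_div_cancel₀ _ hgp]

end Calculus

section HorPart

variable {v w : C3}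

theorem lineCoeff_eq_zero (h : ⟪v, w⟫ = 0) : lineCoeff v w = 0 := by
  rw [lineCoeff, h, zero_div]

theorem lineCoeff_eq_inner (hv : ‖v‖ = 1) (w : C3) : lineCoeff v w = ⟪v, w⟫ := by
  rw [lineCoeff, inner_self_eq_one_of_norm_eq_one hv, div_one]

theorem horPart_eq_self (h : ⟪v, w⟫ = 0) : horPart v w = w := by
  rw [horPart, lineCoeff_eq_zero h, zero_smul, sub_zero]

theorem inner_horPart (hv : v ≠ 0) (w : C3) : ⟪v, horPart v w⟫ = 0 := by
  rw [horPart, lineCoeff, inner_sub_right, inner_smul_right,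
    div_mul_cancel₀ _ (inner_self_ne_zero.2 hv), sub_self]

theorem horPart_add (v w w' : C3) : horPart v (w + w') = horPart v w + horPart v w' := by
  simp only [horPart, lineCoeff, inner_add_right, add_div]
  module

theorem horPart_smul (v w : C3) (c : ℂ) : horPart v (c • w) = c • horPart v w := by
  simp only [horPart, lineCoeff, inner_smul_right, mul_div_assoc]
  module

theorem lineCoeff_add_smul_self (hv : v ≠ 0) (w : C3) (c : ℂ) :
    lineCoeff v (w + c • v) = lineCoeff v w + c := by
  rw [lineCoeff, inner_add_right, inner_smul_right, add_div,
    mul_div_cancel_right₀ _ (inner_self_ne_zero.2 hv), lineCoeff]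

theorem horPart_add_smul_self (hv : v ≠ 0) (w : C3) (c : ℂ) :
    horPart v (w + c • v) = horPart v w := by
  rw [horPart, lineCoeff_add_smul_self hv, horPart]
  module

theorem lineCoeff_smul_left (v w : C3) {c : ℂ} (hc : c ≠ 0) :
    lineCoeff (c • v) w = c⁻¹ * lineCoeff v w := by
  have : (starRingEnd ℂ) c ≠ 0 := (map_ne_zero _).2 hc
  simp only [lineCoeff, inner_smul_left, inner_smul_right]
  field_simp

theorem horPart_smul_left (v w : C3) {c : ℂ} (hc : c ≠ 0) : horPart (c • v) w = horPart v w := by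
  rw [horPart, lineCoeff_smul_left v w hc, smul_smul, mul_right_comm, inv_mul_cancel₀ hc,
    one_mul, horPart]

theorem conjCross_conjCross_self (hv : ‖v‖ = 1) (w : C3) :
    conjCross v (conjCross v w) = -horPart v w := by
  rw [conjCross_conjCross, inner_self_eq_one_of_norm_eq_one hv, one_smul, horPart,
    lineCoeff_eq_inner hv, neg_sub]

theorem conjCross_horPart (v w : C3) : conjCross v (horPart v w) = conjCross v w := by
  rw [horPart, conjCross_sub_right, conjCross_smul_right, conjCross_self, smul_zero, sub_zero]

theorem horPart_conjCross_eq_zero {a b : C3} (hv : ‖v‖ = 1) (ha : ⟪v, a⟫ = 0) (hb : ⟪v, b⟫ = 0) :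
    horPart v (conjCross a b) = 0 := by
  rw [← neg_eq_zero, ← conjCross_conjCross_self hv, conjCross_conjCross v a b, ha, hb, zero_smul,
    zero_smul, sub_zero, conjCross_zero_right]

theorem contDiffOn_lineCoeff {v w : ℂ → C3} {V : Set ℂ} (hv : ContDiffOn ℝ ∞ v V)
    (hw : ContDiffOn ℝ ∞ w V) (hv0 : ∀ z ∈ V, v z ≠ 0) :
    ContDiffOn ℝ ∞ (fun z => lineCoeff (v z) (w z)) V :=
  (hv.inner ℂ hw).mul ((hv.inner ℂ hv).inv fun z hz => inner_self_ne_zero.2 (hv0 z hz))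

end HorPart

section Connection

variable {F : ℂ → C3} {V : Set ℂ} {z : ℂ}

theorem inner_tangentVec (hz : F z ≠ 0) (X : ℂ) : ⟪F z, tangentVec F X z⟫ = 0 :=
  inner_horPart hz _

theorem fderiv_eq_tangentVec_add (F : ℂ → C3) (X z : ℂ) :
    fderiv ℝ F z X = tangentVec F X z + lineCoeff (F z) (fderiv ℝ F z X) • F z := by
  rw [tangentVec, horPart, sub_add_cancel]

theorem tangentVec_eq_re_add_im (F : ℂ → C3) (X z : ℂ) :
    tangentVec F X z = (X.re : ℂ) • tangentVec F 1 z + (X.im : ℂ) • tangentVec F Complex.I z := by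
  have hX : X = X.re • (1 : ℂ) + X.im • Complex.I := by simp
  rw [tangentVec, hX, map_add, map_smul, map_smul, RCLike.real_smul_eq_coe_smul (K := ℂ),
    RCLike.real_smul_eq_coe_smul (K := ℂ), horPart_add, horPart_smul, horPart_smul]
  simp [tangentVec]

theorem contDiffOn_tangentVec (hV : IsOpen V) (hF : ContDiffOn ℝ ∞ F V) (hF0 : ∀ z ∈ V, F z ≠ 0)
    (X : ℂ) : ContDiffOn ℝ ∞ (tangentVec F X) V :=
  (contDiffOn_fderiv_apply hV hF X).sub
    ((contDiffOn_lineCoeff hF (contDiffOn_fderiv_apply hV hF X) hF0).smul hF)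

theorem secondDeriv_eq (hV : IsOpen V) (hF : ContDiffOn ℝ ∞ F V) (hF0 : ∀ z ∈ V, F z ≠ 0)
    (hz : z ∈ V) (X Y : ℂ) :
    secondDeriv F X Y z = horPart (F z) (fderiv ℝ (fun w => fderiv ℝ F w Y) z X)
      - lineCoeff (F z) (fderiv ℝ F z Y) • tangentVec F X z
      - lineCoeff (F z) (fderiv ℝ F z X) • tangentVec F Y z := by
  have hc : DifferentiableAt ℝ (fun w => lineCoeff (F w) (fderiv ℝ F w Y)) z :=
    differentiableAt_of_contDiffOn hV
      (contDiffOn_lineCoeff hF (contDiffOn_fderiv_apply hV hF Y) hF0) hz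
  have hdF : DifferentiableAt ℝ F z := differentiableAt_of_contDiffOn hV hF hz
  have hdFY : DifferentiableAt ℝ (fun w => fderiv ℝ F w Y) z :=
    differentiableAt_of_contDiffOn hV (contDiffOn_fderiv_apply hV hF Y) hz
  have hT : fderiv ℝ (tangentVec F Y) z X = fderiv ℝ (fun w => fderiv ℝ F w Y) z X
      + (-lineCoeff (F z) (fderiv ℝ F z Y)) • fderiv ℝ F z X
      + (-fderiv ℝ (fun w => lineCoeff (F w) (fderiv ℝ F w Y)) z X) • F z := by
    change fderiv ℝ (fun w => fderiv ℝ F w Y - lineCoeff (F w) (fderiv ℝ F w Y) • F w) z X = _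
    rw [fderiv_fun_sub hdFY (hc.fun_smul hdF), sub_apply, fderiv_complex_smul_apply hc hdF]
    module
  rw [secondDeriv, covDeriv, hT, horPart_add_smul_self (hF0 z hz), horPart_add, horPart_smul,
    neg_smul, ← sub_eq_add_neg]
  rfl

theorem secondDeriv_comm (hV : IsOpen V) (hF : ContDiffOn ℝ ∞ F V) (hF0 : ∀ z ∈ V, F z ≠ 0)
    (hz : z ∈ V) (X Y : ℂ) : secondDeriv F X Y z = secondDeriv F Y X z := by
  rw [secondDeriv_eq hV hF hF0 hz, secondDeriv_eq hV hF hF0 hz,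
    fderiv_fderiv_apply_comm hV hF hz X Y, sub_right_comm]

theorem star_inner_fderiv_of_norm_eq_one (hdF : DifferentiableAt ℝ F z)
    (hF1 : ∀ᶠ w in 𝓝 z, ‖F w‖ = 1) (X : ℂ) :
    star ⟪F z, fderiv ℝ F z X⟫ = -⟪F z, fderiv ℝ F z X⟫ := by
  have hconst : (fun w => ⟪F w, F w⟫) =ᶠ[𝓝 z] fun _ => (1 : ℂ) := by
    filter_upwards [hF1] with w hw using inner_self_eq_one_of_norm_eq_one hw
  have hd := fderiv_inner_apply ℂ hdF hdF X
  rw [hconst.fderiv_eq, ← inner_conj_symm (fderiv ℝ F z X)] at hd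
  rw [eq_neg_iff_add_eq_zero, add_comm]
  simpa using hd.symm

/-- Cross product with `F` is the almost complex structure on the horizontal vectors that makes
`F`, `W`, `F × W` special unitary, and it fails to be parallel by three times the connection
form. -/
theorem covDeriv_conjCross {W : ℂ → C3} (hdF : DifferentiableAt ℝ F z)
    (hdW : DifferentiableAt ℝ W z) (hF1 : ∀ᶠ w in 𝓝 z, ‖F w‖ = 1) (hW : ⟪F z, W z⟫ = 0) (X : ℂ) :
    covDeriv F (fun w => conjCross (F w) (W w)) X z = conjCross (F z) (covDeriv F W X z)
      - (3 * ⟪F z, fderiv ℝ F z X⟫) • conjCross (F z) (W z) := by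
  have hFz : ‖F z‖ = 1 := hF1.self_of_nhds
  have hFz0 : F z ≠ 0 := norm_ne_zero_iff.1 (hFz ▸ one_ne_zero)
  have hstar := star_inner_fderiv_of_norm_eq_one hdF hF1 X
  set a := ⟪F z, fderiv ℝ F z X⟫ with ha
  have hvert : horPart (F z) (conjCross (fderiv ℝ F z X) (W z)) =
      -(a • conjCross (F z) (W z)) := by
    rw [fderiv_eq_tangentVec_add, lineCoeff_eq_inner hFz, ← ha, conjCross_add_left, horPart_add,
      horPart_conjCross_eq_zero hFz (inner_tangentVec hFz0 X) hW, zero_add, conjCross_smul_left,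
      horPart_smul, horPart_eq_self (inner_left_conjCross _ _), hstar, neg_smul]
  rw [covDeriv, covDeriv, fderiv_conjCross hdF hdW, horPart_add, hvert,
    horPart_eq_self (inner_left_conjCross _ _), lineCoeff_eq_inner hFz, ← ha, conjCross_sub_right,
    conjCross_horPart, conjCross_smul_right, hstar]
  module

end Connection

/-! ### Phase-normalized lifts -/

section Normalized

variable {F : ℂ → C3} {V : Set ℂ} {z : ℂ}

/-- A lift is phase-normalized if it has unit length and if `F`, `F₁`, `F_I` is a positive multiple
of a special unitary frame in the last two entries, where `F_X` represents `df(X)`. A conformal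
Lagrangian immersion has such lifts locally, unique up to cube roots of unity. -/
structure IsPhaseNormalizedAt (F : ℂ → C3) (z : ℂ) : Prop where
  norm_eq : ‖F z‖ = 1
  tangentVec_I : tangentVec F Complex.I z = conjCross (F z) (tangentVec F 1 z)
  tangentVec_one_ne_zero : tangentVec F 1 z ≠ 0

namespace IsPhaseNormalizedAt

theorem ne_zero (h : IsPhaseNormalizedAt F z) : F z ≠ 0 :=
  norm_ne_zero_iff.1 (h.norm_eq ▸ one_ne_zero)

theorem conjCross_tangentVec_I (h : IsPhaseNormalizedAt F z) :
    conjCross (F z) (tangentVec F Complex.I z) = -tangentVec F 1 z := by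
  rw [h.tangentVec_I, conjCross_conjCross_self h.norm_eq,
    horPart_eq_self (inner_tangentVec h.ne_zero 1)]

theorem inner_tangentVec_tangentVec (h : IsPhaseNormalizedAt F z) (X Y : ℂ) :
    ⟪tangentVec F X z, tangentVec F Y z⟫ =
      ((‖tangentVec F 1 z‖ ^ 2 * (X.re * Y.re + X.im * Y.im) : ℝ) : ℂ) := by
  have h11 : ⟪tangentVec F 1 z, tangentVec F 1 z⟫ = (‖tangentVec F 1 z‖ : ℂ) ^ 2 :=
    inner_self_eq_norm_sq_to_K _
  have h1I : ⟪tangentVec F 1 z, tangentVec F Complex.I z⟫ = 0 := by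
    rw [h.tangentVec_I, inner_right_conjCross]
  have hI1 : ⟪tangentVec F Complex.I z, tangentVec F 1 z⟫ = 0 := inner_eq_zero_symm.1 h1I
  have hII : ⟪tangentVec F Complex.I z, tangentVec F Complex.I z⟫ =
      (‖tangentVec F 1 z‖ : ℂ) ^ 2 := by
    rw [inner_self_eq_norm_sq_to_K, h.tangentVec_I,
      norm_conjCross_of_inner_eq_zero (inner_tangentVec h.ne_zero 1), h.norm_eq, one_mul]
    rfl
  rw [tangentVec_eq_re_add_im F X, tangentVec_eq_re_add_im F Y]
  simp only [inner_add_left, inner_add_right, inner_smul_left, inner_smul_right, h11, h1I, hI1, hII,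
    Complex.conj_ofReal]
  push_cast
  ring

theorem fsHermitian_eq (h : IsPhaseNormalizedAt F z) (X Y : ℂ) :
    fsHermitian F z X Y =
      ((‖tangentVec F 1 z‖ ^ 2 * (X.re * Y.re + X.im * Y.im) : ℝ) : ℂ) := by
  rw [fsHermitian, h.inner_tangentVec_tangentVec, h.norm_eq, one_pow, Complex.ofReal_one, div_one]

theorem inducedMetric_eq (h : IsPhaseNormalizedAt F z) (X Y : ℂ) :
    inducedMetric F z X Y = ‖tangentVec F 1 z‖ ^ 2 * (X.re * Y.re + X.im * Y.im) := by
  rw [inducedMetric, h.fsHermitian_eq, Complex.ofReal_re]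

theorem isConformalImmersionAt (h : IsPhaseNormalizedAt F z) : IsConformalImmersionAt F z := by
  have hpos := norm_pos_iff.2 h.tangentVec_one_ne_zero
  refine ⟨?_, ?_, ?_⟩ <;> simp [h.inducedMetric_eq, hpos]

theorem isLagrangianAt (h : IsPhaseNormalizedAt F z) : IsLagrangianAt F z := fun X Y => by
  rw [inducedKahlerForm, h.fsHermitian_eq, Complex.ofReal_im]

end IsPhaseNormalizedAt

variable (hV : IsOpen V) (hF : ContDiffOn ℝ ∞ F V) (h : ∀ z ∈ V, IsPhaseNormalizedAt F z)

include hV hF h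

theorem secondDeriv_I (hz : z ∈ V) (X : ℂ) :
    secondDeriv F X Complex.I z = conjCross (F z) (secondDeriv F X 1 z)
      - (3 * ⟪F z, fderiv ℝ F z X⟫) • tangentVec F Complex.I z := by
  have hnhds := hV.mem_nhds hz
  have hT : tangentVec F Complex.I =ᶠ[𝓝 z] fun w => conjCross (F w) (tangentVec F 1 w) := by
    filter_upwards [hnhds] with w hw using (h w hw).tangentVec_I
  have hcov : secondDeriv F X Complex.I z =
      covDeriv F (fun w => conjCross (F w) (tangentVec F 1 w)) X z := by
    rw [secondDeriv, covDeriv, hT.fderiv_eq, hT.self_of_nhds, covDeriv]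
  have hF0 : ∀ w ∈ V, F w ≠ 0 := fun w hw => (h w hw).ne_zero
  rw [hcov, covDeriv_conjCross (differentiableAt_of_contDiffOn hV hF hz)
    (differentiableAt_of_contDiffOn hV (contDiffOn_tangentVec hV hF hF0 1) hz)
    (by filter_upwards [hnhds] with w hw using (h w hw).norm_eq) (inner_tangentVec (hF0 z hz) 1),
    secondDeriv, (h z hz).tangentVec_I]

/-- The mean curvature vector is dual to the connection form of the lift: `J` exchanges `F₁` and
`F_I` up to sign, and is parallel up to the connection form, so the symmetry of `∇ df` makes its
trace computable. -/
theorem metricTrace_eq (hz : z ∈ V) :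
    metricTrace F z = (-3 * (‖tangentVec F 1 z‖ : ℂ) ^ 2) •
      (⟪F z, fderiv ℝ F z 1⟫ • tangentVec F 1 z
        + ⟪F z, fderiv ℝ F z Complex.I⟫ • tangentVec F Complex.I z) := by
  have hN := h z hz
  have hdF := differentiableAt_of_contDiffOn hV hF hz
  have hF1 : ∀ᶠ w in 𝓝 z, ‖F w‖ = 1 := by
    filter_upwards [hV.mem_nhds hz] with w hw using (h w hw).norm_eq
  have hhor : horPart (F z) (secondDeriv F 1 1 z) = secondDeriv F 1 1 z := by
    have h0 : ⟪F z, secondDeriv F 1 1 z⟫ = 0 := by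
      rw [secondDeriv, covDeriv, inner_sub_right, inner_smul_right, inner_horPart hN.ne_zero,
        inner_tangentVec hN.ne_zero, mul_zero, sub_zero]
    exact horPart_eq_self h0
  have hsum : secondDeriv F Complex.I Complex.I z = -secondDeriv F 1 1 z
      - (3 * ⟪F z, fderiv ℝ F z 1⟫) • tangentVec F 1 z
      - (3 * ⟪F z, fderiv ℝ F z Complex.I⟫) • tangentVec F Complex.I z := by
    rw [secondDeriv_I hV hF h hz, secondDeriv_comm hV hF (fun w hw => (h w hw).ne_zero) hz,
      secondDeriv_I hV hF h hz, conjCross_sub_right, conjCross_conjCross_self hN.norm_eq, hhor,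
      conjCross_smul_right, hN.conjCross_tangentVec_I, star_mul',
      star_inner_fderiv_of_norm_eq_one hdF hF1]
    simp
  rw [metricTrace, hsum]
  simp only [hN.inducedMetric_eq, Complex.one_re, Complex.one_im, Complex.I_re, Complex.I_im]
  match_scalars <;> simp <;> ring

theorem isMinimalAt_iff_horizontal (hz : z ∈ V) :
    IsMinimalAt F z ↔ ∀ X, ⟪F z, fderiv ℝ F z X⟫ = 0 := by
  have hN := h z hz
  have htr := metricTrace_eq hV hF h hz
  refine ⟨fun hmin X => ?_, fun hhor ν _ _ => by simp [htr, hhor]⟩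
  have hstar := star_inner_fderiv_of_norm_eq_one (differentiableAt_of_contDiffOn hV hF hz)
    (by filter_upwards [hV.mem_nhds hz] with w hw using (h w hw).norm_eq)
  have hlin : ⟪F z, fderiv ℝ F z X⟫ =
      X.re * ⟪F z, fderiv ℝ F z 1⟫ + X.im * ⟪F z, fderiv ℝ F z Complex.I⟫ := by
    have hX : X = X.re • (1 : ℂ) + X.im • Complex.I := by simp
    rw [hX, map_add, map_smul, map_smul, inner_add_right, inner_smul_right_eq_smul,
      inner_smul_right_eq_smul]
    simp
  have htest : ⟪metricTrace F z, Complex.I • tangentVec F X z⟫ =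
      (3 * ‖tangentVec F 1 z‖ ^ 4 : ℝ) * (Complex.I * ⟪F z, fderiv ℝ F z X⟫) := by
    simp only [htr, inner_smul_left, inner_smul_right, inner_add_left,
      hN.inner_tangentVec_tangentVec, ← RCLike.star_def, hstar, hlin, star_mul', star_neg,
      star_pow, star_ofNat]
    simp only [RCLike.star_def, Complex.conj_ofReal, Complex.one_re, Complex.one_im, Complex.I_re,
      Complex.I_im]
    push_cast
    ring
  -- The normal vectors are the `i df(X)`, since the immersion is Lagrangian.
  have hnormal : ⟪metricTrace F z, Complex.I • tangentVec F X z⟫.re = 0 :=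
    hmin _ (by rw [inner_smul_right, inner_tangentVec hN.ne_zero, mul_zero]) fun Y => by
      rw [inner_smul_right, hN.inner_tangentVec_tangentVec, Complex.I_mul_re, Complex.ofReal_im,
        neg_zero]
  rw [htest, Complex.re_ofReal_mul, Complex.I_mul_re, mul_neg, neg_eq_zero] at hnormal
  have hpos := norm_pos_iff.2 hN.tangentVec_one_ne_zero
  have hre := congrArg Complex.re (hstar X)
  rw [RCLike.star_def, Complex.conj_re, Complex.neg_re] at hre
  exact Complex.ext (self_eq_neg.1 hre) ((mul_eq_zero.1 hnormal).resolve_left (by positivity))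

end Normalized

section Rescaling

variable {F : ℂ → C3} {l : ℂ → ℂ} {V : Set ℂ} {z : ℂ}

theorem tangentVec_smul (hl : DifferentiableAt ℝ l z) (hF : DifferentiableAt ℝ F z)
    (hl0 : l z ≠ 0) (hF0 : F z ≠ 0) (X : ℂ) :
    tangentVec (fun z => l z • F z) X z = l z • tangentVec F X z := by
  rw [tangentVec, fderiv_complex_smul_apply hl hF, horPart_smul_left _ _ hl0,
    horPart_add_smul_self hF0, horPart_smul, tangentVec]

theorem fsHermitian_smul (hl : DifferentiableAt ℝ l z) (hF : DifferentiableAt ℝ F z)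
    (hl0 : l z ≠ 0) (hF0 : F z ≠ 0) (X Y : ℂ) :
    fsHermitian (fun z => l z • F z) z X Y = fsHermitian F z X Y := by
  have h : (starRingEnd ℂ) (l z) ≠ 0 := (map_ne_zero _).2 hl0
  rw [fsHermitian, tangentVec_smul hl hF hl0 hF0, tangentVec_smul hl hF hl0 hF0, inner_smul_left,
    inner_smul_right, fsHermitian, norm_smul, mul_pow, Complex.ofReal_mul, Complex.ofReal_pow ‖l z‖,
    ← Complex.conj_mul', ← mul_assoc, mul_div_mul_left _ _ (mul_ne_zero h hl0)]

theorem secondDeriv_smul (hV : IsOpen V) (hl : ContDiffOn ℝ ∞ l V) (hF : ContDiffOn ℝ ∞ F V)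
    (hl0 : ∀ z ∈ V, l z ≠ 0) (hF0 : ∀ z ∈ V, F z ≠ 0) (hz : z ∈ V) (X Y : ℂ) :
    secondDeriv (fun z => l z • F z) X Y z = l z • secondDeriv F X Y z := by
  have hdl : ∀ w ∈ V, DifferentiableAt ℝ l w := fun w hw => differentiableAt_of_contDiffOn hV hl hw
  have hdF : ∀ w ∈ V, DifferentiableAt ℝ F w := fun w hw => differentiableAt_of_contDiffOn hV hF hw
  have hT : tangentVec (fun z => l z • F z) Y =ᶠ[𝓝 z] fun z => l z • tangentVec F Y z := by
    filter_upwards [hV.mem_nhds hz] with w hw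
    exact tangentVec_smul (hdl w hw) (hdF w hw) (hl0 w hw) (hF0 w hw) Y
  have hdT : DifferentiableAt ℝ (tangentVec F Y) z :=
    differentiableAt_of_contDiffOn hV (contDiffOn_tangentVec hV hF hF0 Y) hz
  have hlz := hl0 z hz
  have hcoeff : lineCoeff (l z • F z) (l z • fderiv ℝ F z X + fderiv ℝ l z X • F z) * l z =
      l z * lineCoeff (F z) (fderiv ℝ F z X) + fderiv ℝ l z X := by
    rw [lineCoeff_smul_left _ _ hlz, lineCoeff_add_smul_self (hF0 z hz), lineCoeff,
      inner_smul_right, mul_div_assoc, mul_right_comm, inv_mul_cancel₀ hlz, one_mul, lineCoeff]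
  rw [secondDeriv, covDeriv, hT.fderiv_eq, fderiv_complex_smul_apply (hdl z hz) hdT,
    hT.self_of_nhds, fderiv_complex_smul_apply (hdl z hz) (hdF z hz), horPart_smul_left _ _ hlz,
    smul_smul, hcoeff, horPart_add, horPart_smul, horPart_smul,
    horPart_eq_self (inner_tangentVec (hF0 z hz) Y), secondDeriv, covDeriv]
  module

/-- A smooth local lift of a conformal minimal Lagrangian immersion. -/
structure IsMinimalLagrangianLift (F : ℂ → C3) (f : ℂ → CP2) (V : Set ℂ) : Prop where
  isLocalLift : IsLocalLift F f V
  conformal : ∀ z ∈ V, IsConformalImmersionAt F z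
  lagrangian : ∀ z ∈ V, IsLagrangianAt F z
  minimal : ∀ z ∈ V, IsMinimalAt F z

namespace IsMinimalLagrangianLift

variable {f : ℂ → CP2}

theorem ne_zero (h : IsMinimalLagrangianLift F f V) {z : ℂ} (hz : z ∈ V) : F z ≠ 0 :=
  IsRep.ne_zero (h.isLocalLift.lift z hz)

theorem differentiableAt (h : IsMinimalLagrangianLift F f V) {z : ℂ} (hz : z ∈ V) :
    DifferentiableAt ℝ F z :=
  differentiableAt_of_contDiffOn h.isLocalLift.isOpen h.isLocalLift.smooth hz

theorem mono (h : IsMinimalLagrangianLift F f V) {W : Set ℂ} (hW : IsOpen W) (hWV : W ⊆ V) :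
    IsMinimalLagrangianLift F f W :=
  ⟨⟨hW, h.isLocalLift.smooth.mono hWV, fun z hz => h.isLocalLift.lift z (hWV hz)⟩,
    fun z hz => h.conformal z (hWV hz), fun z hz => h.lagrangian z (hWV hz),
    fun z hz => h.minimal z (hWV hz)⟩

theorem smul (h : IsMinimalLagrangianLift F f V) (hl : ContDiffOn ℝ ∞ l V)
    (hl0 : ∀ z ∈ V, l z ≠ 0) : IsMinimalLagrangianLift (fun z => l z • F z) f V := by
  have hV := h.isLocalLift.isOpen
  have hdl : ∀ z ∈ V, DifferentiableAt ℝ l z := fun z hz => differentiableAt_of_contDiffOn hV hl hz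
  have hH : ∀ z ∈ V, ∀ X Y, fsHermitian (fun z => l z • F z) z X Y = fsHermitian F z X Y :=
    fun z hz => fsHermitian_smul (hdl z hz) (h.differentiableAt hz) (hl0 z hz) (h.ne_zero hz)
  have hM : ∀ z ∈ V, ∀ X Y, inducedMetric (fun z => l z • F z) z X Y = inducedMetric F z X Y :=
    fun z hz X Y => by rw [inducedMetric, hH z hz, inducedMetric]
  refine ⟨⟨hV, hl.smul h.isLocalLift.smooth, fun z hz => ?_⟩, fun z hz => ?_, fun z hz X Y => ?_,
    fun z hz ν hν hνT => ?_⟩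
  · exact IsRep.smul (h.isLocalLift.lift z hz) (hl0 z hz)
  · have := h.conformal z hz
    rwa [IsConformalImmersionAt, ← hM z hz, ← hM z hz, ← hM z hz] at this
  · have := h.lagrangian z hz X Y
    rwa [inducedKahlerForm, ← hH z hz] at this
  · have htr : metricTrace (fun z => l z • F z) z = l z • metricTrace F z := by
      simp only [metricTrace, hM z hz, secondDeriv_smul hV hl h.isLocalLift.smooth hl0
        (fun _ => h.ne_zero) hz]
      match_scalars <;> ring
    have hmin := h.minimal z hz ((starRingEnd ℂ) (l z) • ν)
      (by rwa [inner_smul_right, ← inner_smul_left])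
      (fun X => by
        rw [inner_smul_right, ← inner_smul_left, ← tangentVec_smul (hdl z hz)
          (h.differentiableAt hz) (hl0 z hz) (h.ne_zero hz)]
        exact hνT X)
    rwa [inner_smul_right, ← inner_smul_left, ← htr] at hmin

theorem exists_norm_eq_one (h : IsMinimalLagrangianLift F f V) :
    ∃ G, IsMinimalLagrangianLift G f V ∧ ∀ z ∈ V, ‖G z‖ = 1 := by
  have hn : ∀ z ∈ V, ‖F z‖ ≠ 0 := fun z hz => norm_ne_zero_iff.2 (h.ne_zero hz)
  have hsmooth : ContDiffOn ℝ ∞ (fun z => ‖F z‖) V :=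
    h.isLocalLift.smooth.norm ℝ fun z hz => h.ne_zero hz
  refine ⟨fun z => ((‖F z‖⁻¹ : ℝ) : ℂ) • F z,
    h.smul (Complex.ofRealCLM.contDiff.comp_contDiffOn (hsmooth.inv hn))
      fun z hz => Complex.ofReal_ne_zero.2 (inv_ne_zero (hn z hz)), fun z hz => ?_⟩
  rw [norm_smul, Complex.norm_real, norm_inv, norm_norm, inv_mul_cancel₀ (hn z hz)]

end IsMinimalLagrangianLift

theorem exists_conjCross_eq_smul {a b c : C3} (ha : ‖a‖ = 1) (hb : b ≠ 0) (hab : ⟪a, b⟫ = 0)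
    (hac : ⟪a, c⟫ = 0) (hbc : ⟪b, c⟫ = 0) (hnorm : ‖b‖ = ‖c‖) :
    ∃ k : ℂ, ‖k‖ = 1 ∧ conjCross a b = k • c := by
  have hn : ‖conjCross a b‖ = ‖c‖ := by
    rw [norm_conjCross_of_inner_eq_zero hab, ha, one_mul, hnorm]
  have hc : ‖c‖ ≠ 0 := hnorm ▸ norm_ne_zero_iff.2 hb
  set n := conjCross a b
  have hnn : ⟪n, n⟫ ≠ 0 := inner_self_ne_zero.2 (norm_ne_zero_iff.1 (hn ▸ hc))
  have hexp : ⟪n, n⟫ • c = ⟪n, c⟫ • n := by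
    have := inner_conjCross_self_smul a b c
    rwa [hac, hbc, zero_mul, zero_mul, zero_mul, zero_mul, sub_zero, zero_smul, zero_smul, add_zero,
      add_zero] at this
  obtain ⟨k, rfl⟩ : ∃ k : ℂ, c = k • n :=
    ⟨⟪n, c⟫ / ⟪n, n⟫, by rw [div_eq_inv_mul, mul_smul, ← hexp, inv_smul_smul₀ hnn]⟩
  have hk : ‖k‖ = 1 := by
    rw [norm_smul] at hn hc
    exact (right_eq_mul₀ (right_ne_zero_of_mul hc)).1 hn
  exact ⟨k⁻¹, by rw [norm_inv, hk, inv_one],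
    (inv_smul_smul₀ (norm_ne_zero_iff.1 (hk ▸ one_ne_zero)) n).symm⟩

namespace IsMinimalLagrangianLift

variable {f : ℂ → CP2}

theorem tangentVec_ne_zero (h : IsMinimalLagrangianLift F f V) (hz : z ∈ V) :
    tangentVec F 1 z ≠ 0 ∧ tangentVec F Complex.I z ≠ 0 := by
  obtain ⟨hpos, heq, -⟩ := h.conformal z hz
  refine ⟨fun h0 => ?_, fun h0 => ?_⟩
  · simp [inducedMetric, fsHermitian, h0] at hpos
  · rw [heq] at hpos
    simp [inducedMetric, fsHermitian, h0] at hpos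

theorem exists_conjCross_tangentVec_eq_smul (h : IsMinimalLagrangianLift F f V) (hz : z ∈ V)
    (hF1 : ‖F z‖ = 1) :
    ∃ k : ℂ, ‖k‖ = 1 ∧ conjCross (F z) (tangentVec F 1 z) = k • tangentVec F Complex.I z := by
  have hH (X Y : ℂ) : fsHermitian F z X Y = ⟪tangentVec F X z, tangentVec F Y z⟫ := by
    simp [fsHermitian, hF1]
  obtain ⟨-, heq, hzero⟩ := h.conformal z hz
  refine exists_conjCross_eq_smul hF1 (h.tangentVec_ne_zero hz).1
    (inner_tangentVec (h.ne_zero hz) _) (inner_tangentVec (h.ne_zero hz) _) ?_ ?_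
  · rw [← hH]
    exact Complex.ext hzero (h.lagrangian z hz 1 Complex.I)
  · have hre (X : ℂ) : inducedMetric F z X X = ‖tangentVec F X z‖ ^ 2 := by
      rw [inducedMetric, hH, inner_self_eq_norm_sq_to_K]
      norm_cast
    rw [hre, hre] at heq
    exact (sq_eq_sq₀ (norm_nonneg _) (norm_nonneg _)).1 heq

theorem exists_contDiffOn_conjCross_tangentVec_eq_smul (h : IsMinimalLagrangianLift F f V)
    (hF1 : ∀ z ∈ V, ‖F z‖ = 1) : ∃ κ : ℂ → ℂ, ContDiffOn ℝ ∞ κ V ∧ ∀ z ∈ V, ‖κ z‖ = 1 ∧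
      conjCross (F z) (tangentVec F 1 z) = κ z • tangentVec F Complex.I z := by
  have hT := contDiffOn_tangentVec h.isLocalLift.isOpen h.isLocalLift.smooth fun _ => h.ne_zero
  have hTT : ∀ z ∈ V, ⟪tangentVec F Complex.I z, tangentVec F Complex.I z⟫ ≠ 0 := fun z hz =>
    inner_self_ne_zero.2 (h.tangentVec_ne_zero hz).2
  refine ⟨fun z => ⟪tangentVec F Complex.I z, conjCross (F z) (tangentVec F 1 z)⟫ *
    ⟪tangentVec F Complex.I z, tangentVec F Complex.I z⟫⁻¹,
    ((hT _).inner ℂ (contDiffOn_conjCross h.isLocalLift.smooth (hT 1))).mul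
      (((hT _).inner ℂ (hT _)).inv hTT), fun z hz => ?_⟩
  obtain ⟨k, hk, heq⟩ := h.exists_conjCross_tangentVec_eq_smul hz (hF1 z hz)
  beta_reduce
  rw [heq, inner_smul_right, mul_assoc, mul_inv_cancel₀ (hTT z hz), mul_one]
  exact ⟨hk, rfl⟩

/-- Multiplying a lift by the phase `l` multiplies `F × F₁` by `l̄²` and `F_I` by `l`, so a smooth
cube root of their ratio normalizes the phase. -/
theorem exists_isPhaseNormalizedAt (h : IsMinimalLagrangianLift F f V) (hp : z ∈ V) :
    ∃ W ⊆ V, z ∈ W ∧ ∃ G, IsMinimalLagrangianLift G f W ∧ ∀ w ∈ W, IsPhaseNormalizedAt G w := by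
  obtain ⟨F, h, hF1⟩ := h.exists_norm_eq_one
  obtain ⟨κ, hκsmooth, hκ⟩ := h.exists_contDiffOn_conjCross_tangentVec_eq_smul hF1
  obtain ⟨W, hWV, hW, hzW, l, hl, hl3⟩ := exists_contDiffOn_pow_eq three_ne_zero
    h.isLocalLift.isOpen hκsmooth hp (norm_ne_zero_iff.1 ((hκ z hp).1 ▸ one_ne_zero))
  have hl1 : ∀ w ∈ W, ‖l w‖ = 1 := fun w hw => by
    rw [← pow_eq_one_iff_of_nonneg (norm_nonneg _) three_ne_zero, ← norm_pow, hl3 w hw,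
      (hκ w (hWV hw)).1]
  have hl0 : ∀ w ∈ W, l w ≠ 0 := fun w hw => norm_ne_zero_iff.1 (hl1 w hw ▸ one_ne_zero)
  refine ⟨W, hWV, hzW, fun w => l w • F w, (h.mono hW hWV).smul hl hl0, fun w hw => ?_⟩
  have hTl := tangentVec_smul (differentiableAt_of_contDiffOn hW hl hw)
    (h.differentiableAt (hWV hw)) (hl0 w hw) (h.ne_zero (hWV hw))
  refine ⟨by rw [norm_smul, hl1 w hw, hF1 w (hWV hw), one_mul], ?_, ?_⟩
  · have hstar : star (l w) * l w = 1 := by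
      simp [RCLike.star_def, Complex.conj_mul', hl1 w hw]
    rw [hTl, hTl, conjCross_smul_left, conjCross_smul_right, (hκ w (hWV hw)).2, ← hl3 w hw,
      smul_smul, smul_smul]
    congr 1
    linear_combination -(l w) * (star (l w) * l w + 1) * hstar
  · rw [hTl]
    exact smul_ne_zero (hl0 w hw) (h.tangentVec_ne_zero (hWV hw)).1

end IsMinimalLagrangianLift

end Rescaling

/-! ### Special lifts -/

section Special

variable {F G : ℂ → C3} {f : ℂ → CP2} {V W : Set ℂ} {z : ℂ}

/-- A phase-normalized lift is special if it is horizontal for the Hopf fibration. These are the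
conformal special Legendrian maps to `S⁵`. -/
structure IsSpecialAt (F : ℂ → C3) (z : ℂ) : Prop extends IsPhaseNormalizedAt F z where
  horizontal : ∀ X, ⟪F z, fderiv ℝ F z X⟫ = 0

namespace IsSpecialAt

theorem tangentVec_eq (h : IsSpecialAt F z) (X : ℂ) : tangentVec F X z = fderiv ℝ F z X :=
  horPart_eq_self (h.horizontal X)

theorem fderiv_I (h : IsSpecialAt F z) :
    fderiv ℝ F z Complex.I = conjCross (F z) (fderiv ℝ F z 1) := by
  rw [← h.tangentVec_eq, h.tangentVec_I, h.tangentVec_eq]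

theorem fderiv_one_ne_zero (h : IsSpecialAt F z) : fderiv ℝ F z 1 ≠ 0 :=
  h.tangentVec_eq 1 ▸ h.tangentVec_one_ne_zero

theorem of_fderiv_one (hnorm : ‖F z‖ = 1) (hhor : ⟪F z, fderiv ℝ F z 1⟫ = 0)
    (hI : fderiv ℝ F z Complex.I = conjCross (F z) (fderiv ℝ F z 1)) (hne : fderiv ℝ F z 1 ≠ 0) :
    IsSpecialAt F z := by
  have hhorX (X : ℂ) : ⟪F z, fderiv ℝ F z X⟫ = 0 := by
    have hX : X = X.re • (1 : ℂ) + X.im • Complex.I := by simp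
    rw [hX, map_add, map_smul, map_smul, hI, inner_add_right, inner_smul_right_eq_smul,
      inner_smul_right_eq_smul, hhor, inner_left_conjCross, smul_zero, smul_zero, add_zero]
  have hT (X : ℂ) : tangentVec F X z = fderiv ℝ F z X := horPart_eq_self (hhorX X)
  exact ⟨⟨hnorm, by rw [hT, hT, hI], by rwa [hT]⟩, hhorX⟩

theorem fderiv_I_mul (h : IsSpecialAt F z) (X : ℂ) :
    fderiv ℝ F z (Complex.I * X) = conjCross (F z) (fderiv ℝ F z X) := by
  have hX : X = X.re • (1 : ℂ) + X.im • Complex.I := by simp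
  have hIX : Complex.I * X = X.re • Complex.I + X.im • (-1 : ℂ) := by
    apply Complex.ext <;> simp
  have hII : conjCross (F z) (fderiv ℝ F z Complex.I) = -fderiv ℝ F z 1 := by
    rw [← h.tangentVec_eq, ← h.tangentVec_eq, h.conjCross_tangentVec_I]
  rw [hIX, hX]
  simp only [map_add, map_smul, map_neg, conjCross_add_right, conjCross_real_smul_right, hII,
    ← h.fderiv_I]
  simp

theorem fderiv_ne_zero (h : IsSpecialAt F z) {X : ℂ} (hX : X ≠ 0) : fderiv ℝ F z X ≠ 0 := by
  intro h0
  have hIX : fderiv ℝ F z (Complex.I * X) = 0 := by rw [h.fderiv_I_mul, h0, conjCross_zero_right]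
  have hone : (1 : ℂ) = X⁻¹.re • X + X⁻¹.im • (Complex.I * X) := by
    rw [Complex.real_smul, Complex.real_smul, ← mul_assoc, ← add_mul, Complex.re_add_im,
      inv_mul_cancel₀ hX]
  apply h.fderiv_one_ne_zero
  rw [hone, map_add, map_smul, map_smul, h0, hIX, smul_zero, smul_zero, add_zero]

end IsSpecialAt

/-- A smooth map on the open set `V` that is a special lift at every point. -/
structure IsSpecialOn (F : ℂ → C3) (V : Set ℂ) : Prop where
  isOpen : IsOpen V
  smooth : ContDiffOn ℝ ∞ F V
  special : ∀ z ∈ V, IsSpecialAt F z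

/-- The pointwise relation between a map to `ℂP²` and a lift. -/
def IsLiftOn (F : ℂ → C3) (f : ℂ → CP2) (V : Set ℂ) : Prop := ∀ z ∈ V, IsRep (F z) (f z)

theorem isMinimalLagrangianImmersion_iff_exists_isSpecialOn {U : Set ℂ} :
    IsMinimalLagrangianImmersion f U ↔
      ∀ p ∈ U, ∃ V F, p ∈ V ∧ V ⊆ U ∧ IsSpecialOn F V ∧ IsLiftOn F f V := by
  refine forall₂_congr fun p _ => ⟨?_, ?_⟩
  · rintro ⟨V, F, hpV, hVU, hl, hF⟩
    have hF' : IsMinimalLagrangianLift F f V :=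
      ⟨hl, fun z hz => (hF z hz).1, fun z hz => (hF z hz).2.1, fun z hz => (hF z hz).2.2⟩
    obtain ⟨W, hWV, hpW, G, hG, hGN⟩ := hF'.exists_isPhaseNormalizedAt hpV
    obtain ⟨hW, hGsmooth, hGlift⟩ := hG.isLocalLift
    exact ⟨W, G, hpW, hWV.trans hVU, ⟨hW, hGsmooth, fun z hz => ⟨hGN z hz,
      (isMinimalAt_iff_horizontal hW hGsmooth hGN hz).1 (hG.minimal z hz)⟩⟩, hGlift⟩
  · rintro ⟨V, F, hpV, hVU, hF, hl⟩
    have hFN : ∀ z ∈ V, IsPhaseNormalizedAt F z := fun z hz =>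
      (hF.special z hz).toIsPhaseNormalizedAt
    exact ⟨V, F, hpV, hVU, ⟨hF.isOpen, hF.smooth, hl⟩, fun z hz =>
      ⟨(hFN z hz).isConformalImmersionAt, (hFN z hz).isLagrangianAt,
        (isMinimalAt_iff_horizontal hF.isOpen hF.smooth hFN hz).2 (hF.special z hz).horizontal⟩⟩

namespace IsSpecialOn

theorem differentiableAt (h : IsSpecialOn F V) (hz : z ∈ V) : DifferentiableAt ℝ F z :=
  differentiableAt_of_contDiffOn h.isOpen h.smooth hz

theorem mono (h : IsSpecialOn F V) (hW : IsOpen W) (hWV : W ⊆ V) : IsSpecialOn F W :=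
  ⟨hW, h.smooth.mono hWV, fun z hz => h.special z (hWV hz)⟩

theorem comp (h : IsSpecialOn F V) {φ φ' : ℂ → ℂ} (hW : IsOpen W) (hmaps : Set.MapsTo φ W V)
    (hd : ∀ w ∈ W, HasDerivAt φ (φ' w) w) (hne : ∀ w ∈ W, φ' w ≠ 0) :
    IsSpecialOn (F ∘ φ) W := by
  have hφ : ContDiffOn ℂ ∞ φ W := DifferentiableOn.contDiffOn
    (fun w hw => (hd w hw).differentiableAt.differentiableWithinAt) hW
  refine ⟨hW, h.smooth.comp (hφ.restrict_scalars ℝ) hmaps, fun w hw => ?_⟩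
  have hs := h.special _ (hmaps hw)
  have hderiv (X : ℂ) : fderiv ℝ (F ∘ φ) w X = fderiv ℝ F (φ w) (φ' w * X) := by
    have hφw := (hd w hw).hasFDerivAt.restrictScalars ℝ
    rw [((h.differentiableAt (hmaps hw)).hasFDerivAt.comp w hφw).fderiv]
    simp [mul_comm]
  refine .of_fderiv_one hs.norm_eq ?_ ?_ ?_
  · rw [hderiv, Function.comp_apply, hs.horizontal]
  · rw [hderiv, hderiv, mul_one, mul_comm, hs.fderiv_I_mul, Function.comp_apply]
  · rw [hderiv, mul_one]
    exact hs.fderiv_ne_zero (hne w hw)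

theorem comp_add_const (h : IsSpecialOn F V) (c : ℂ) :
    IsSpecialOn (fun z => F (z + c)) ((fun z => z + c) ⁻¹' V) :=
  h.comp (φ := fun z => z + c) (φ' := fun _ => 1) (h.isOpen.preimage (by fun_prop))
    (Set.mapsTo_preimage _ _) (fun w _ => (hasDerivAt_id w).add_const c) fun _ _ => one_ne_zero

theorem map (h : IsSpecialOn F V) {U : C3 →L[ℂ] C3} (hU : IsSU U) :
    IsSpecialOn (fun z => U (F z)) V := by
  have hderiv : ∀ z ∈ V, ∀ X, fderiv ℝ (fun z => U (F z)) z X = U (fderiv ℝ F z X) :=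
    fun z hz X => congrArg (· X)
      ((U.restrictScalars ℝ).hasFDerivAt.comp z (h.differentiableAt hz).hasFDerivAt).fderiv
  refine ⟨h.isOpen, (U.restrictScalars ℝ).contDiff.comp_contDiffOn h.smooth, fun z hz => ?_⟩
  have hs := h.special z hz
  refine .of_fderiv_one (by rw [hU.norm_map, hs.norm_eq]) ?_ ?_ ?_
  · rw [hderiv z hz, hU.inner_map, hs.horizontal]
  · rw [hderiv z hz, hderiv z hz, hs.fderiv_I, hU.map_conjCross]
  · rw [hderiv z hz]
    exact hU.map_ne_zero hs.fderiv_one_ne_zero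

theorem fderiv_inner_eq_zero (hF : IsSpecialOn F V) (hG : IsSpecialOn G V) (hz : z ∈ V)
    (hFG : ∃ c : ℂ, F z = c • G z) : fderiv ℝ (fun z => ⟪G z, F z⟫) z = 0 := by
  obtain ⟨c, hc⟩ := hFG
  have hc0 : c ≠ 0 := by
    rintro rfl
    exact (hF.special z hz).ne_zero (by rw [hc, zero_smul])
  ext1 X
  have hGX : ⟪fderiv ℝ G z X, F z⟫ = 0 := by
    rw [hc, inner_smul_right, inner_eq_zero_symm.1 ((hG.special z hz).horizontal X), mul_zero]
  have hFX : ⟪G z, fderiv ℝ F z X⟫ = 0 := by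
    have := (hF.special z hz).horizontal X
    rw [hc, inner_smul_left] at this
    exact (mul_eq_zero.1 this).resolve_left ((map_ne_zero _).2 hc0)
  rw [fderiv_inner_apply ℂ (hG.differentiableAt hz) (hF.differentiableAt hz), hGX, hFX, add_zero,
    zero_apply]

theorem pow_three_eq_one_of_eventuallyEq (hF : IsSpecialAt F z) (hG : IsSpecialAt G z)
    (hdG : DifferentiableAt ℝ G z) {c : ℂ} (hFG : F =ᶠ[𝓝 z] fun z => c • G z) : c ^ 3 = 1 := by
  have hderiv (X : ℂ) : fderiv ℝ F z X = c • fderiv ℝ G z X := by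
    rw [hFG.fderiv_eq, fderiv_fun_const_smul hdG]
    rfl
  have hc1 : ‖c‖ = 1 := by
    have := congrArg norm hFG.self_of_nhds
    rwa [norm_smul, hF.norm_eq, hG.norm_eq, mul_one, eq_comm] at this
  have hstar : star c * c = 1 := by
    simp [RCLike.star_def, Complex.conj_mul', hc1]
  have hI := hF.fderiv_I
  rw [hderiv, hderiv, hFG.self_of_nhds, conjCross_smul_left, conjCross_smul_right, ← hG.fderiv_I,
    smul_smul] at hI
  have hc := smul_left_injective ℂ (hG.fderiv_ne_zero Complex.I_ne_zero) hI
  rw [pow_succ]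
  linear_combination c ^ 2 * hc + (star c * c + 1) * hstar

theorem exists_eq_smul (hF : IsSpecialOn F V) (hG : IsSpecialOn G V) (hV : IsPreconnected V)
    (hFG : ∀ z ∈ V, ∃ c : ℂ, F z = c • G z) :
    ∃ c : ℂ, c ^ 3 = 1 ∧ ∀ z ∈ V, F z = c • G z := by
  rcases V.eq_empty_or_nonempty with rfl | ⟨z₀, hz₀⟩
  · exact ⟨1, one_pow 3, by simp⟩
  have hinner : ∀ z ∈ V, F z = ⟪G z, F z⟫ • G z := fun z hz => by
    obtain ⟨c, hc⟩ := hFG z hz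
    rw [hc, inner_smul_right, inner_self_eq_one_of_norm_eq_one (hG.special z hz).norm_eq, mul_one]
  have hconst : ∀ z ∈ V, ⟪G z, F z⟫ = ⟪G z₀, F z₀⟫ := fun z hz =>
    hF.isOpen.is_const_of_fderiv_eq_zero hV
      (fun w hw =>
        ((hG.differentiableAt hw).inner ℂ (hF.differentiableAt hw)).differentiableWithinAt)
      (fun w hw => hF.fderiv_inner_eq_zero hG hw (hFG w hw)) hz hz₀
  have heq : ∀ z ∈ V, F z = ⟪G z₀, F z₀⟫ • G z := fun z hz => by rw [← hconst z hz, ← hinner z hz]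
  exact ⟨_, pow_three_eq_one_of_eventuallyEq (hF.special z₀ hz₀) (hG.special z₀ hz₀)
    (hG.differentiableAt hz₀) (by filter_upwards [hF.isOpen.mem_nhds hz₀] using heq), heq⟩

end IsSpecialOn

theorem IsLiftOn.exists_eq_smul (hF : IsLiftOn F f V) (hG : IsLiftOn G f V) :
    ∀ z ∈ V, ∃ c : ℂ, F z = c • G z := fun z hz =>
  let ⟨c, _, hc⟩ := (hF z hz).exists_smul (hG z hz)
  ⟨c, hc⟩

end Special

/-! ### One-parameter groups and their generators -/

section Flow

variable {E : Type*} [NormedAddCommGroup E] [NormedSpace ℂ E]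

/-- The one-parameter group of linear maps generated by `A`. -/
noncomputable def flow (A : E →L[ℂ] E) (t : ℝ) : E →L[ℂ] E := NormedSpace.exp (t • A)

theorem flow_zero (A : E →L[ℂ] E) : flow A 0 = 1 := by
  rw [flow, zero_smul ℝ A, NormedSpace.exp_zero]

theorem flow_zero_apply (A : E →L[ℂ] E) (v : E) : flow A 0 v = v := by
  rw [flow_zero]
  rfl

variable [CompleteSpace E]

theorem flow_add (A : E →L[ℂ] E) (s t : ℝ) : flow A (s + t) = flow A s * flow A t := by
  let _ : NormedAlgebra ℚ (E →L[ℂ] E) := NormedAlgebra.restrictScalars ℚ ℂ _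
  rw [flow, add_smul s t A, NormedSpace.exp_add_of_commute, flow, flow]
  exact ((Commute.refl A).smul_left s).smul_right t

theorem flow_add_apply (A : E →L[ℂ] E) (s t : ℝ) (v : E) :
    flow A (s + t) v = flow A s (flow A t v) := by
  rw [flow_add]
  rfl

theorem hasDerivAt_flow (A : E →L[ℂ] E) (t : ℝ) : HasDerivAt (flow A) (A * flow A t) t :=
  hasDerivAt_exp_smul_const' A t

theorem flow_map (A : E →L[ℂ] E) (t : ℝ) (v : E) : flow A t (A v) = A (flow A t v) :=
  congrArg (· v) ((hasDerivAt_exp_smul_const A t).unique (hasDerivAt_flow A t))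

theorem hasDerivAt_flow_apply (A : E →L[ℂ] E) (v : E) (t : ℝ) :
    HasDerivAt (fun t => flow A t v) (A (flow A t v)) t :=
  ((ContinuousLinearMap.apply ℂ E v).restrictScalars ℝ).hasFDerivAt.comp_hasDerivAt t
    (hasDerivAt_flow A t)

theorem contDiff_flow (A : E →L[ℂ] E) : ContDiff ℝ ∞ (flow A) :=
  contDiff_iff_contDiffAt.2 fun t =>
    (NormedSpace.exp_analytic (𝕂 := ℝ) (t • A)).contDiffAt.comp t
      (contDiff_id.smul contDiff_const).contDiffAt

theorem eqOn_flow {A : E →L[ℂ] E} {w : ℝ → E} {s : Set ℝ} (hs : IsOpen s) (hs' : IsPreconnected s)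
    (h0 : 0 ∈ s) (hw : ∀ t ∈ s, HasDerivAt w (A (w t)) t) :
    s.EqOn w fun t => flow A t (w 0) := by
  have hd : ∀ t ∈ s, HasDerivAt (fun t => flow A (-t) (w t)) 0 t := by
    intro t ht
    have hflow : HasDerivAt (fun t => (flow A (-t)).restrictScalars ℝ)
        ((-(A * flow A (-t))).restrictScalars ℝ) t :=
      (ContinuousLinearMap.restrictScalarsL ℂ E E ℝ ℝ).hasFDerivAt.comp_hasDerivAt t
        (by simpa [Function.comp_def] using (hasDerivAt_flow A (-t)).scomp t (hasDerivAt_neg t))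
    exact (hflow.clm_apply (hw t ht)).congr_deriv (neg_add_eq_zero.2 (flow_map A (-t) (w t)).symm)
  intro t ht
  have hconst : flow A (-t) (w t) = flow A (-0) (w 0) :=
    hs.is_const_of_deriv_eq_zero hs'
      (fun t ht => (hd t ht).differentiableAt.differentiableWithinAt)
      (fun t ht => (hd t ht).deriv) ht h0
  rw [neg_zero, flow_zero_apply] at hconst
  change w t = flow A t (w 0)
  rw [← hconst, ← flow_add_apply, add_neg_cancel, flow_zero_apply]

end Flow

section Generator

variable {F : ℂ → C3} {f : ℂ → CP2} {V : Set ℂ} {w₀ w z : ℂ} {r t : ℝ} {R : ℝ → Equiv.Perm CP2}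
  {A U : C3 →L[ℂ] C3}

theorem hasDerivAt_conjCross {a b : ℝ → C3} {a' b' : C3} (ha : HasDerivAt a a' t)
    (hb : HasDerivAt b b' t) :
    HasDerivAt (fun t => conjCross (a t) (b t)) (conjCross (a t) b' + conjCross a' (b t)) t :=
  conjCrossL.hasDerivAt_of_bilinear (fun _ => ha) fun _ => hb

/-- Membership in the Lie algebra of `SU(3)`, in the encoding of `IsSU`. -/
structure IsInfinitesimalSU (A : C3 →L[ℂ] C3) : Prop where
  skew : ∀ a b, ⟪A a, b⟫ + ⟪a, A b⟫ = 0
  map_conjCross : ∀ a b, A (conjCross a b) = conjCross a (A b) + conjCross (A a) b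

theorem IsInfinitesimalSU.isSU_flow (hA : IsInfinitesimalSU A) (t : ℝ) : IsSU (flow A t) := by
  refine ⟨fun a b => ?_, fun a b => ?_⟩
  · have hd (t : ℝ) : HasDerivAt (fun t => ⟪flow A t a, flow A t b⟫) 0 t := by
      have h := (hasDerivAt_flow_apply A a t).inner ℂ (hasDerivAt_flow_apply A b t)
      rwa [add_comm, hA.skew] at h
    have hconst : ⟪flow A t a, flow A t b⟫ = ⟪flow A 0 a, flow A 0 b⟫ :=
      is_const_of_deriv_eq_zero (fun t => (hd t).differentiableAt) (fun t => (hd t).deriv) t 0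
    rwa [flow_zero_apply, flow_zero_apply] at hconst
  · have h := eqOn_flow (A := A) (w := fun t => conjCross (flow A t a) (flow A t b)) isOpen_univ
      isPreconnected_univ (Set.mem_univ 0) (fun t _ => by
        rw [hA.map_conjCross]
        exact hasDerivAt_conjCross (hasDerivAt_flow_apply A a t) (hasDerivAt_flow_apply A b t))
      (Set.mem_univ t)
    simpa only [flow_zero_apply] using h.symm

theorem isInfinitesimalSU_of_hasDerivAt {T : ℝ → C3 →L[ℂ] C3} (hT0 : T 0 = 1)
    (hT : HasDerivAt T A 0) (hSU : ∀ᶠ t in 𝓝 0, IsSU (T t)) : IsInfinitesimalSU A := by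
  have hTv (v : C3) : HasDerivAt (fun t => T t v) (A v) 0 :=
    ((ContinuousLinearMap.apply ℂ C3 v).restrictScalars ℝ).hasFDerivAt.comp_hasDerivAt 0 hT
  have hT0v (v : C3) : T 0 v = v := by rw [hT0]; rfl
  refine ⟨fun a b => ?_, fun a b => ?_⟩
  · have hd := (hTv a).inner ℂ (hTv b)
    have hconst : (fun t => ⟪T t a, T t b⟫) =ᶠ[𝓝 0] fun _ => ⟪a, b⟫ := by
      filter_upwards [hSU] with t ht using ht.inner_map a b
    rw [hT0v, hT0v, add_comm] at hd
    exact hd.unique ((hasDerivAt_const 0 _).congr_of_eventuallyEq hconst)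
  · have hd := hasDerivAt_conjCross (hTv a) (hTv b)
    have heq : (fun t => T t (conjCross a b)) =ᶠ[𝓝 0] fun t => conjCross (T t a) (T t b) := by
      filter_upwards [hSU] with t ht using ht.map_conjCross a b
    rw [hT0v, hT0v] at hd
    exact (hTv _).unique (hd.congr_of_eventuallyEq heq)

theorem hasDerivAt_comp_add_ofReal {E : Type*} [NormedAddCommGroup E] [NormedSpace ℝ E] {F : ℂ → E}
    (hF : DifferentiableAt ℝ F (w + t)) :
    HasDerivAt (fun t : ℝ => F (w + t)) (fderiv ℝ F (w + t) 1) t :=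
  hF.hasFDerivAt.comp_hasDerivAt t (by simpa using (Complex.ofRealCLM.hasDerivAt).const_add w)

theorem hasDerivAt_comp_add_ofReal_zero {E : Type*} [NormedAddCommGroup E] [NormedSpace ℝ E]
    {F : ℂ → E} (hF : DifferentiableAt ℝ F w) :
    HasDerivAt (fun t : ℝ => F (w + t)) (fderiv ℝ F w 1) 0 := by
  simpa using hasDerivAt_comp_add_ofReal (w := w) (t := 0) (by simpa using hF)

theorem fderiv_add_apply_of_map_eq (hF : DifferentiableAt ℝ F w)
    (h : ∀ᶠ z in 𝓝 w, F (z + t) = U (F z)) (X : ℂ) :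
    fderiv ℝ F (w + t) X = U (fderiv ℝ F w X) := by
  have hU : (fun z => F (z + t)) =ᶠ[𝓝 w] U.restrictScalars ℝ ∘ F := h
  rw [← fderiv_comp_add_right (t : ℂ), hU.fderiv_eq,
    ((U.restrictScalars ℝ).hasFDerivAt.comp w hF.hasFDerivAt).fderiv]
  rfl

/-- The linear map carrying the frame `F`, `∂₁F`, `∂_I F` at `w₀` to the same frame at `w`, when
`F` is special at `w₀`, so that the frame there is orthogonal. -/
noncomputable def frameTransport (F : ℂ → C3) (w₀ w : ℂ) : C3 →L[ℂ] C3 :=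
  (innerSL ℂ (F w₀)).smulRight (F w) + ⟪fderiv ℝ F w₀ 1, fderiv ℝ F w₀ 1⟫⁻¹ •
    ((innerSL ℂ (fderiv ℝ F w₀ 1)).smulRight (fderiv ℝ F w 1)
      + (innerSL ℂ (fderiv ℝ F w₀ Complex.I)).smulRight (fderiv ℝ F w Complex.I))

theorem IsSpecialAt.frameTransport_eq (h : IsSpecialAt F w₀) (hU : F w = U (F w₀))
    (hdU : ∀ X, fderiv ℝ F w X = U (fderiv ℝ F w₀ X)) : frameTransport F w₀ w = U := by
  ext1 v
  set b := fderiv ℝ F w₀ 1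
  have hb : ⟪b, b⟫ ≠ 0 := inner_self_ne_zero.2 h.fderiv_one_ne_zero
  have hab : ⟪F w₀, b⟫ = 0 := h.horizontal 1
  have haa : ⟪F w₀, F w₀⟫ = 1 := inner_self_eq_one_of_norm_eq_one h.norm_eq
  have hexp := inner_conjCross_self_smul (F w₀) b v
  rw [inner_conjCross_conjCross, hab, inner_eq_zero_symm.1 hab, haa, ← h.fderiv_I] at hexp
  have hv : v = ⟪F w₀, v⟫ • F w₀ + ⟪b, b⟫⁻¹ • (⟪b, v⟫ • b
      + ⟪fderiv ℝ F w₀ Complex.I, v⟫ • fderiv ℝ F w₀ Complex.I) := by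
    refine smul_right_injective _ hb ?_
    simp only [smul_add, smul_inv_smul₀ hb]
    rw [zero_mul, one_mul, mul_one, mul_zero, mul_zero, sub_zero, sub_zero, sub_zero] at hexp
    rw [hexp, mul_comm, mul_smul]
    abel
  conv_rhs => rw [hv]
  simp only [map_add, map_smul, ← hU, b, ← hdU]
  rfl

theorem IsSpecialOn.differentiableAt_frameTransport (h : IsSpecialOn F V) (hw : w ∈ V) (w₀ : ℂ) :
    DifferentiableAt ℝ (frameTransport F w₀) w := by
  have hsmulRight {a : C3} {g : ℂ → C3} (hg : DifferentiableAt ℝ g w) :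
      DifferentiableAt ℝ (fun w => (innerSL ℂ a).smulRight (g w)) w :=
    ((ContinuousLinearMap.smulRightL ℂ C3 C3 (innerSL ℂ a)).restrictScalars
      ℝ).differentiableAt.comp w hg
  have hderiv (X : ℂ) : DifferentiableAt ℝ (fun w => fderiv ℝ F w X) w :=
    differentiableAt_of_contDiffOn h.isOpen (contDiffOn_fderiv_apply h.isOpen h.smooth X) hw
  exact (hsmulRight (h.differentiableAt hw)).fun_add
    (((hsmulRight (hderiv 1)).fun_add (hsmulRight (hderiv Complex.I))).fun_const_smul _)

theorem add_mem_ball {E : Type*} [SeminormedAddCommGroup E] {x₀ x y : E} {r s : ℝ}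
    (hx : x ∈ Metric.ball x₀ s) (hr : ‖y‖ + s ≤ r) : x + y ∈ Metric.ball x₀ r := by
  rw [mem_ball_iff_norm] at hx ⊢
  calc ‖x + y - x₀‖ = ‖(x - x₀) + y‖ := by abel_nf
    _ ≤ ‖x - x₀‖ + ‖y‖ := norm_add_le _ _
    _ < r := by linarith

theorem IsSpecialOn.exists_add_eq_smul_map (hF : IsSpecialOn F (Metric.ball w₀ r))
    (hl : IsLiftOn F f (Metric.ball w₀ r)) {T : CP2 → CP2} (hU : IsSU U)
    (hUT : ∀ v, InducesAt U T v) (hf : ∀ w ∈ Metric.ball w₀ r, f (w + t) = T (f w))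
    (ht : |t| < r / 2) :
    ∃ c : ℂ, c ^ 3 = 1 ∧ ∀ w ∈ Metric.ball w₀ (r / 2), F (w + t) = c • U (F w) := by
  have hsub : Metric.ball w₀ (r / 2) ⊆ Metric.ball w₀ r :=
    Metric.ball_subset_ball (by linarith [abs_nonneg t])
  have hadd : ∀ w ∈ Metric.ball w₀ (r / 2), w + t ∈ Metric.ball w₀ r := fun w hw =>
    add_mem_ball hw (by rw [Complex.norm_real, Real.norm_eq_abs]; linarith)
  have hlT : IsLiftOn (fun w => F (w + t)) (T ∘ f) (Metric.ball w₀ (r / 2)) := fun w hw =>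
    (congrArg (IsRep _) (hf w (hsub hw))).mp (hl _ (hadd w hw))
  have hlU : IsLiftOn (fun w => U (F w)) (T ∘ f) (Metric.ball w₀ (r / 2)) := fun w hw =>
    hUT _ _ (hl w (hsub hw))
  exact ((hF.comp_add_const t).mono Metric.isOpen_ball hadd).exists_eq_smul
    ((hF.mono Metric.isOpen_ball hsub).map hU) (convex_ball _ _).isPreconnected
    (hlT.exists_eq_smul hlU)

section

variable (hF : IsSpecialOn F (Metric.ball w₀ r)) (hl : IsLiftOn F f (Metric.ball w₀ r))
  (hR : IsOneParameterIsometryGroup R)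
  (hf : ∀ t : ℝ, ∀ w ∈ Metric.ball w₀ r, f (w + t) = R t (f w))

include hF hl hR hf

theorem IsSpecialOn.frameTransport_add (ht : |t| < r / 2) :
    IsSU (frameTransport F w₀ (w₀ + t)) ∧ (∀ v, InducesAt (frameTransport F w₀ (w₀ + t)) (R t) v) ∧
      ∀ w ∈ Metric.ball w₀ (r / 2), F (w + t) = frameTransport F w₀ (w₀ + t) (F w) := by
  have hr : 0 < r := by linarith [abs_nonneg t]
  have hw₀ : w₀ ∈ Metric.ball w₀ r := Metric.mem_ball_self hr
  obtain ⟨U, hU, hUR⟩ := hR.exists_isSU t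
  obtain ⟨c, hc, hcF⟩ := hF.exists_add_eq_smul_map hl hU hUR (hf t) ht
  have hc0 : c ≠ 0 := (IsUnit.of_pow_eq_one hc three_ne_zero).ne_zero
  have hT : frameTransport F w₀ (w₀ + t) = c • U := by
    refine (hF.special w₀ hw₀).frameTransport_eq (hcF w₀ (Metric.mem_ball_self (by linarith)))
      (fderiv_add_apply_of_map_eq (hF.differentiableAt hw₀) ?_)
    filter_upwards [Metric.ball_mem_nhds w₀ (half_pos hr)] using hcF
  rw [hT]
  exact ⟨hU.smul hc, fun v p hp => (hUR v p hp).smul hc0, hcF⟩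

theorem IsSpecialOn.exists_fderiv_one_eq (hr : 0 < r) :
    ∃ A, IsInfinitesimalSU A ∧ ∀ w ∈ Metric.ball w₀ (r / 2), fderiv ℝ F w 1 = A (F w) := by
  have hw₀ : w₀ ∈ Metric.ball w₀ r := Metric.mem_ball_self hr
  have hsub : Metric.ball w₀ (r / 2) ⊆ Metric.ball w₀ r := Metric.ball_subset_ball (by linarith)
  have hSU (t : ℝ) (ht : |t| < r / 2) := hF.frameTransport_add hl hR hf ht
  have hnear : ∀ᶠ t : ℝ in 𝓝 0, |t| < r / 2 := by
    simpa using eventually_abs_sub_lt (0 : ℝ) (half_pos hr)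
  have hT0 : frameTransport F w₀ (w₀ + (0 : ℝ)) = 1 := by
    simpa using (hF.special w₀ hw₀).frameTransport_eq (w := w₀) (U := 1) rfl fun _ => rfl
  have hT := hasDerivAt_comp_add_ofReal_zero (hF.differentiableAt_frameTransport hw₀ w₀)
  refine ⟨fderiv ℝ (frameTransport F w₀) w₀ 1,
    isInfinitesimalSU_of_hasDerivAt hT0 hT (hnear.mono fun t ht => (hSU t ht).1), fun w hw => ?_⟩
  have hTF := ((ContinuousLinearMap.apply ℂ C3 (F w)).restrictScalars
    ℝ).hasFDerivAt.comp_hasDerivAt 0 hT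
  refine (hasDerivAt_comp_add_ofReal_zero (hF.differentiableAt (hsub hw))).unique
    (hTF.congr_of_eventuallyEq ?_)
  filter_upwards [hnear] with t ht using (hSU t ht).2.2 w hw

omit hl hR hf in
theorem IsSpecialOn.frameTransport_add_eq_flow
    (hA : ∀ w ∈ Metric.ball w₀ r, fderiv ℝ F w 1 = A (F w)) (ht : |t| < r / 2) :
    frameTransport F w₀ (w₀ + t) = flow A t := by
  have hr : 0 < r := by linarith [abs_nonneg t]
  have hw₀ : w₀ ∈ Metric.ball w₀ r := Metric.mem_ball_self hr
  have hflow : ∀ w ∈ Metric.ball w₀ (r / 2), F (w + t) = flow A t (F w) := by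
    intro w hw
    have hmem : ∀ s ∈ Set.Ioo (-(r / 2)) (r / 2), w + (s : ℝ) ∈ Metric.ball w₀ r :=
      fun s hs => add_mem_ball hw
        (by rw [Complex.norm_real, Real.norm_eq_abs]; linarith [abs_lt.2 hs])
    have h := eqOn_flow (A := A) (w := fun t : ℝ => F (w + t)) isOpen_Ioo isPreconnected_Ioo
      ⟨by linarith, by linarith⟩ (fun s hs => hA _ (hmem s hs) ▸
        hasDerivAt_comp_add_ofReal (hF.differentiableAt (hmem s hs))) (abs_lt.1 ht)
    simpa using h
  refine (hF.special w₀ hw₀).frameTransport_eq (hflow w₀ (Metric.mem_ball_self (half_pos hr)))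
    (fderiv_add_apply_of_map_eq (hF.differentiableAt hw₀) ?_)
  filter_upwards [Metric.ball_mem_nhds w₀ (half_pos hr)] using hflow

omit hF hl hf in
theorem inducesAt_flow_of_forall_abs_lt {ε : ℝ} (hε : 0 < ε)
    (h : ∀ t, |t| < ε → ∀ v, InducesAt (flow A t) (R t) v) (t : ℝ) (v : C3) :
    InducesAt (flow A t) (R t) v := by
  intro p hp
  obtain ⟨n, hn⟩ := exists_nat_gt (|t| / ε)
  have hn0 : (0 : ℝ) < n := lt_of_le_of_lt (by positivity) hn
  have hs : |t / n| < ε := by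
    rwa [abs_div, Nat.abs_cast, div_lt_iff₀ hn0, mul_comm, ← div_lt_iff₀ hε]
  have hmul (k : ℕ) : IsRep (flow A (k * (t / n)) v) (R (k * (t / n)) p) := by
    induction k with
    | zero => simpa [hR.map_zero, flow_zero_apply] using hp
    | succ k ih =>
      rw [Nat.cast_succ, add_one_mul, add_comm, flow_add_apply, hR.add]
      exact h _ hs _ _ ih
  simpa [mul_div_cancel₀ _ hn0.ne'] using hmul n

theorem IsSpecialOn.exists_generator (hr : 0 < r) :
    ∃ A, IsInfinitesimalSU A ∧ ∀ t v, InducesAt (flow A t) (R t) v := by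
  obtain ⟨A, hA, hAF⟩ := hF.exists_fderiv_one_eq hl hR hf hr
  refine ⟨A, hA, inducesAt_flow_of_forall_abs_lt hR (by linarith : 0 < r / 4) fun t ht => ?_⟩
  rw [← (hF.mono Metric.isOpen_ball (Metric.ball_subset_ball
    (half_le_self hr.le))).frameTransport_add_eq_flow hAF (by linarith)]
  exact (hF.frameTransport_add hl hR hf (by linarith)).2.1

end

theorem IsSpecialOn.fderiv_one_eq (hF : IsSpecialOn F V) (hl : IsLiftOn F f V)
    (hf : ∀ t : ℝ, ∀ w ∈ V, f (w + t) = R t (f w)) (hA : IsInfinitesimalSU A)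
    (hAR : ∀ t v, InducesAt (flow A t) (R t) v) (hw : w ∈ V) : fderiv ℝ F w 1 = A (F w) := by
  obtain ⟨r, hr, hrV⟩ := Metric.isOpen_iff.1 hF.isOpen w hw
  have hFF : ⟪F w, F w⟫ = 1 :=
    inner_self_eq_one_of_norm_eq_one (hF.special w hw).norm_eq
  have hdF := hasDerivAt_comp_add_ofReal_zero (hF.differentiableAt hw)
  have hdA := hasDerivAt_flow_apply A (F w) 0
  rw [flow_zero_apply] at hdA
  set c : ℝ → ℂ := fun t => ⟪flow A t (F w), F (w + t)⟫
  have hdc : HasDerivAt c (deriv c 0) 0 := (hdA.inner ℂ hdF).differentiableAt.hasDerivAt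
  have hc : ∀ᶠ t : ℝ in 𝓝 0, c t ^ 3 = 1 ∧ F (w + t) = c t • flow A t (F w) := by
    filter_upwards [eventually_abs_sub_lt (0 : ℝ) (half_pos hr)] with t ht
    rw [sub_zero] at ht
    obtain ⟨k, hk, h⟩ := (hF.mono Metric.isOpen_ball hrV).exists_add_eq_smul_map
      (fun z hz => hl z (hrV hz)) (hA.isSU_flow t) (hAR t) (fun z hz => hf t z (hrV hz)) ht
    have hFk := h w (Metric.mem_ball_self (half_pos hr))
    have hck : c t = k := by
      simp only [c, hFk, inner_smul_right, (hA.isSU_flow t).inner_map, hFF, mul_one]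
    exact ⟨hck ▸ hk, hck ▸ hFk⟩
  have hc0 : c 0 = 1 := by
    simpa only [c, flow_zero_apply, Complex.ofReal_zero, add_zero] using hFF
  have hdc0 : deriv c 0 = 0 := by
    have h := (hdc.pow 3).unique
      ((hasDerivAt_const (0 : ℝ) (1 : ℂ)).congr_of_eventuallyEq (hc.mono fun t ht => ht.1))
    simpa [hc0] using h
  have h := hdF.unique ((hdc.smul hdA).congr_of_eventuallyEq (hc.mono fun t ht => ht.2))
  simpa [hdc0, hc0] using h

end Generator

/-! ### Complete vector fields -/

section IntegralCurve

theorem exists_hasDerivAt_of_hasCompactSupport {E : Type*} [NormedAddCommGroup E] [NormedSpace ℝ E]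
    [CompleteSpace E] {v : E → E} (hv : ContDiff ℝ 1 v) (hc : HasCompactSupport v) (x₀ : E) :
    ∃ γ : ℝ → E, γ 0 = x₀ ∧ ∀ t, HasDerivAt γ (v (γ t)) t := by
  obtain ⟨K, hK⟩ := hv.lipschitzWith_of_hasCompactSupport hc one_ne_zero
  obtain ⟨C, hC⟩ := hv.continuous.bounded_above_of_compact_support hc
  suffices h : ∃ γ : ℝ → E, γ 0 = x₀ ∧ IsMIntegralCurve (I := modelWithCornersSelf ℝ E) γ v from
    h.imp fun γ ⟨hγ0, hγ⟩ => ⟨hγ0, fun t => hasDerivAt_iff_hasFDerivAt.2 (hγ t).hasFDerivAt⟩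
  refine (exists_isMIntegralCurve_iff_exists_isMIntegralCurveOn_Ioo
    (contMDiff_vectorSpace_iff_contDiff.2 hv) x₀).2 fun T => ?_
  rcases le_or_gt T 0 with hT | hT
  · exact ⟨fun _ => x₀, rfl, by simp [IsMIntegralCurveOn, Set.Ioo_eq_empty, hT]⟩
  have hpl : IsPicardLindelof (fun _ => v) (tmin := -T) (tmax := T)
      ⟨0, by constructor <;> linarith⟩ x₀ (C.toNNReal * T.toNNReal) 0 C.toNNReal K :=
    .of_time_independent (fun x _ => (hC x).trans (Real.le_coe_toNNReal C)) hK.lipschitzOnWith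
      (by simp [Real.coe_toNNReal T hT.le])
  obtain ⟨γ, hγ0, hγ⟩ := hpl.exists_eq_forall_mem_Icc_hasDerivWithinAt₀
  exact ⟨γ, hγ0, fun t ht => ((hγ t (Set.Ioo_subset_Icc_self ht)).mono
    Set.Ioo_subset_Icc_self).hasFDerivWithinAt.hasMFDerivWithinAt⟩

theorem exists_hasDerivAt_of_inner_self_eq_zero {E : Type*} [NormedAddCommGroup E]
    [InnerProductSpace ℝ E] [FiniteDimensional ℝ E] {v : E → E} (hv : ContDiff ℝ 1 v)
    (horth : ∀ x, inner ℝ x (v x) = 0) (x₀ : E) :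
    ∃ γ : ℝ → E, γ 0 = x₀ ∧ (∀ t, HasDerivAt γ (v (γ t)) t) ∧ ∀ t, ‖γ t‖ = ‖x₀‖ := by
  have : CompleteSpace E := FiniteDimensional.complete ℝ E
  let χ : ContDiffBump (0 : E) :=
    ⟨‖x₀‖ + 1, ‖x₀‖ + 2, by positivity, by linarith⟩
  obtain ⟨γ, hγ0, hγ⟩ := exists_hasDerivAt_of_hasCompactSupport (χ.contDiff.smul hv)
    χ.hasCompactSupport.smul_right x₀
  have hd (t : ℝ) : HasDerivAt (fun t => ‖γ t‖ ^ 2) 0 t := by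
    simpa [inner_smul_right, horth] using (hγ t).norm_sq
  have hnorm (t : ℝ) : ‖γ t‖ = ‖x₀‖ := by
    have hconst := is_const_of_deriv_eq_zero (fun t => (hd t).differentiableAt)
      (fun t => (hd t).deriv) t 0
    rwa [hγ0, sq_eq_sq₀ (norm_nonneg _) (norm_nonneg _)] at hconst
  refine ⟨γ, hγ0, fun t => ?_, hnorm⟩
  have hχ : χ (γ t) = 1 := χ.one_of_mem_closedBall <| by
    rw [mem_closedBall_zero_iff, hnorm]
    exact (lt_add_one _).le
  simpa [hχ] using hγ t

theorem contDiff_infty_of_hasDerivAt {E : Type*} [NormedAddCommGroup E] [NormedSpace ℝ E]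
    {v : E → E} (hv : ContDiff ℝ ∞ v) {γ : ℝ → E} (hγ : ∀ t, HasDerivAt γ (v (γ t)) t) :
    ContDiff ℝ ∞ γ := by
  have hd : deriv γ = v ∘ γ := funext fun t => (hγ t).deriv
  refine contDiff_infty.2 fun n => ?_
  induction n with
  | zero => exact contDiff_zero.2 (continuous_iff_continuousAt.2 fun t => (hγ t).continuousAt)
  | succ n ih =>
    rw [Nat.cast_succ, contDiff_succ_iff_deriv, hd]
    exact ⟨fun t => (hγ t).differentiableAt, by simp, (contDiff_infty.1 hv n).comp ih⟩

end IntegralCurve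

/-! ### Equivariant special lifts -/

section Equivariant

variable {F G : ℂ → C3} {V W : Set ℂ} {w z : ℂ} {A : C3 →L[ℂ] C3} {γ : ℝ → C3} {v : C3}

theorem contDiff_conjCross_map (A : C3 →L[ℂ] C3) : ContDiff ℝ ∞ fun x => conjCross x (A x) :=
  conjCrossL.isBoundedBilinearMap.contDiff.comp
    (contDiff_id.prodMk (A.restrictScalars ℝ).contDiff)

/-- A special lift on which translation by `t` acts, infinitesimally, as the one-parameter group
generated by `A`. -/
structure IsEquivariantSpecialOn (A : C3 →L[ℂ] C3) (F : ℂ → C3) (V : Set ℂ) : Prop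
    extends IsSpecialOn F V where
  fderiv_one : ∀ z ∈ V, fderiv ℝ F z 1 = A (F z)

/-- The vector field on `ℂ³` along which the equivariant special lifts with generator `A` move when
the parameter moves in the direction `X`. -/
noncomputable def directionField (A : C3 →L[ℂ] C3) (X : ℂ) (x : C3) : C3 :=
  X.re • A x + X.im • conjCross x (A x)

theorem contDiff_directionField (A : C3 →L[ℂ] C3) (X : ℂ) : ContDiff ℝ ∞ (directionField A X) :=
  ((A.restrictScalars ℝ).contDiff.const_smul X.re).add
    ((contDiff_conjCross_map A).const_smul X.im)

namespace IsEquivariantSpecialOn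

theorem fderiv_apply (h : IsEquivariantSpecialOn A F V) (hz : z ∈ V) (X : ℂ) :
    fderiv ℝ F z X = directionField A X (F z) := by
  have hX : X = X.re • (1 : ℂ) + X.im • Complex.I := by simp
  conv_lhs => rw [hX]
  rw [map_add, map_smul, map_smul, (h.special z hz).fderiv_I, h.fderiv_one z hz, directionField]

theorem mono (h : IsEquivariantSpecialOn A F V) (hW : IsOpen W) (hWV : W ⊆ V) :
    IsEquivariantSpecialOn A F W :=
  ⟨h.toIsSpecialOn.mono hW hWV, fun z hz => h.fderiv_one z (hWV hz)⟩

theorem const_smul (h : IsEquivariantSpecialOn A F V) {c : ℂ} (hc : c ^ 3 = 1) :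
    IsEquivariantSpecialOn A (fun z => c • F z) V := by
  have hone : IsSU (1 : C3 →L[ℂ] C3) := ⟨fun _ _ => rfl, fun _ _ => rfl⟩
  refine ⟨h.toIsSpecialOn.map (hone.smul hc), fun z hz => ?_⟩
  rw [fderiv_fun_const_smul (h.differentiableAt hz), map_smul, ← h.fderiv_one z hz]
  rfl

theorem comp_add_const (h : IsEquivariantSpecialOn A F V) (c : ℂ) :
    IsEquivariantSpecialOn A (fun z => F (z + c)) ((fun z => z + c) ⁻¹' V) :=
  ⟨h.toIsSpecialOn.comp_add_const c, fun z hz => by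
    rw [fderiv_comp_add_right, h.fderiv_one _ hz]⟩

theorem hasDerivAt_segment (h : IsEquivariantSpecialOn A F V) {t : ℝ}
    (ht : w + t • (z - w) ∈ V) :
    HasDerivAt (fun t : ℝ => F (w + t • (z - w)))
      (directionField A (z - w) (F (w + t • (z - w)))) t := by
  have hsegment : HasDerivAt (fun t : ℝ => w + t • (z - w)) (z - w) t := by
    simpa using ((hasDerivAt_id t).smul_const (z - w)).const_add w
  rw [← h.fderiv_apply ht]
  exact (h.differentiableAt ht).hasFDerivAt.comp_hasDerivAt t hsegment

theorem eqOn_of_eq (hF : IsEquivariantSpecialOn A F V) (hG : IsEquivariantSpecialOn A G V)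
    (hV : Convex ℝ V) (hw : w ∈ V) (hFG : F w = G w) : V.EqOn F G := by
  intro z hz
  obtain ⟨K, hK⟩ := ((contDiff_directionField A (z - w)).of_le
    (mod_cast le_top : (1 : WithTop ℕ∞) ≤ ∞)).contDiffOn.exists_lipschitzOnWith one_ne_zero
    (convex_closedBall (0 : C3) 1) (isCompact_closedBall 0 1)
  have hmem : ∀ t ∈ Set.Icc (0 : ℝ) 1, w + t • (z - w) ∈ V := fun t ht =>
    hV.add_smul_sub_mem hw hz ht
  have hunit {H : ℂ → C3} (hH : IsEquivariantSpecialOn A H V) : ∀ t ∈ Set.Ico (0 : ℝ) 1,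
      H (w + t • (z - w)) ∈ Metric.closedBall 0 1 := fun t ht => by
    rw [mem_closedBall_zero_iff, (hH.special _ (hmem t (Set.Ico_subset_Icc_self ht))).norm_eq]
  have hderiv {H : ℂ → C3} (hH : IsEquivariantSpecialOn A H V) (t : ℝ) (ht : t ∈ Set.Icc 0 1) :=
    hH.hasDerivAt_segment (hmem t ht)
  have h := ODE_solution_unique_of_mem_Icc_right (s := fun _ => Metric.closedBall 0 1)
    (fun _ _ => hK)
    (fun t ht => (hderiv hF t ht).continuousAt.continuousWithinAt)
    (fun t ht => (hderiv hF t (Set.Ico_subset_Icc_self ht)).hasDerivWithinAt) (hunit hF)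
    (fun t ht => (hderiv hG t ht).continuousAt.continuousWithinAt)
    (fun t ht => (hderiv hG t (Set.Ico_subset_Icc_self ht)).hasDerivWithinAt) (hunit hG)
    (by simpa using hFG) (Set.right_mem_Icc.2 zero_le_one)
  simpa using h

theorem exists_eq_smul_of_eventually (hF : IsEquivariantSpecialOn A F V)
    (hG : IsEquivariantSpecialOn A G V) (hV : Convex ℝ V) (hw : w ∈ V)
    (hFG : ∀ᶠ z in 𝓝 w, ∃ c : ℂ, F z = c • G z) :
    ∃ c : ℂ, c ^ 3 = 1 ∧ ∀ z ∈ V, F z = c • G z := by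
  obtain ⟨r, hr, hrV⟩ := Metric.mem_nhds_iff.1
    (Filter.inter_mem (hF.isOpen.mem_nhds hw) hFG)
  have hball : Metric.ball w r ⊆ V := fun z hz => (hrV hz).1
  obtain ⟨c, hc, hcG⟩ := (hF.toIsSpecialOn.mono Metric.isOpen_ball hball).exists_eq_smul
    (hG.toIsSpecialOn.mono Metric.isOpen_ball hball) (convex_ball w r).isPreconnected
    fun z hz => (hrV hz).2
  exact ⟨c, hc, hF.eqOn_of_eq (hG.const_smul hc) hV hw (hcG w (Metric.mem_ball_self hr))⟩

end IsEquivariantSpecialOn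

theorem exists_hasDerivAt_conjCross_map (A : C3 →L[ℂ] C3) (v : C3) :
    ∃ γ : ℝ → C3, γ 0 = v ∧ (∀ t, HasDerivAt γ (conjCross (γ t) (A (γ t))) t) ∧
      ∀ t, ‖γ t‖ = ‖v‖ :=
  exists_hasDerivAt_of_inner_self_eq_zero (contDiff_infty.1 (contDiff_conjCross_map A) 1)
    (fun x => congrArg Complex.re (inner_left_conjCross x (A x))) v

theorem IsInfinitesimalSU.inner_map_eq_of_hasDerivAt (hA : IsInfinitesimalSU A)
    (hγ : ∀ t, HasDerivAt γ (conjCross (γ t) (A (γ t))) t) (s t : ℝ) :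
    ⟪γ s, A (γ s)⟫ = ⟪γ t, A (γ t)⟫ := by
  have hd (t : ℝ) : HasDerivAt (fun t => ⟪γ t, A (γ t)⟫) 0 t := by
    have h := (hγ t).inner ℂ (((A.restrictScalars ℝ).hasFDerivAt).comp_hasDerivAt t (hγ t))
    refine h.congr_deriv ?_
    simp only [Function.comp_apply, ContinuousLinearMap.coe_restrictScalars']
    rw [eq_neg_of_add_eq_zero_right (hA.skew _ _), inner_right_conjCross,
      inner_eq_zero_symm.1 (inner_right_conjCross _ _), neg_zero, add_zero]
  exact is_const_of_deriv_eq_zero (fun t => (hd t).differentiableAt) (fun t => (hd t).deriv) s t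

theorem map_ne_zero_of_hasDerivAt (hγ : ∀ t, HasDerivAt γ (conjCross (γ t) (A (γ t))) t)
    (h0 : A (γ 0) ≠ 0) (t : ℝ) : A (γ t) ≠ 0 := by
  intro ht
  have hconst : IsMIntegralCurve (I := modelWithCornersSelf ℝ C3) (fun _ : ℝ => γ t)
      fun x => conjCross x (A x) := fun s => by
    have h := (hasDerivAt_const s (γ t)).hasFDerivAt.hasMFDerivAt
    rwa [← conjCross_zero_right (γ t), ← ht] at h
  have hcurve : IsMIntegralCurve (I := modelWithCornersSelf ℝ C3) γ fun x => conjCross x (A x) :=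
    fun s => (hγ s).hasFDerivAt.hasMFDerivAt
  have heq : γ = fun _ => γ t :=
    isMIntegralCurve_Ioo_eq_of_contMDiff_boundaryless (t₀ := t)
      (contMDiff_vectorSpace_iff_contDiff.2 (contDiff_infty.1 (contDiff_conjCross_map A) 1))
      hcurve hconst rfl
  rw [heq] at h0
  exact h0 ht

theorem hasFDerivAt_flow_re_im {γ' : C3} (hγ : HasDerivAt γ γ' w.im) :
    HasFDerivAt (fun w : ℂ => flow A w.re (γ w.im))
      (Complex.reCLM.smulRight (A (flow A w.re (γ w.im)))
        + Complex.imCLM.smulRight (flow A w.re γ')) w := by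
  have hflow : HasFDerivAt (fun w : ℂ => (flow A w.re).restrictScalars ℝ)
      (Complex.reCLM.smulRight ((A * flow A w.re).restrictScalars ℝ)) w := by
    have h := ((ContinuousLinearMap.restrictScalarsL ℂ C3 C3 ℝ ℝ).hasFDerivAt.comp_hasDerivAt _
      (hasDerivAt_flow A w.re)).hasFDerivAt.comp w Complex.reCLM.hasFDerivAt
    refine h.congr_fderiv ?_
    ext1 X
    simp
  have h := hflow.clm_apply (hγ.hasFDerivAt.comp w Complex.imCLM.hasFDerivAt)
  refine h.congr_fderiv ?_
  ext1 X
  simp [add_comm]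

theorem IsInfinitesimalSU.exists_isEquivariantSpecialOn_univ (hA : IsInfinitesimalSU A)
    (hv : ‖v‖ = 1) (hvA : ⟪v, A v⟫ = 0) (hAv : A v ≠ 0) :
    ∃ Γ : ℂ → C3, IsEquivariantSpecialOn A Γ Set.univ ∧ Γ 0 = v := by
  obtain ⟨γ, rfl, hγ, hnorm⟩ := exists_hasDerivAt_conjCross_map A v
  set Γ : ℂ → C3 := fun w => flow A w.re (γ w.im) with hΓ
  have hΓd (w : ℂ) := (hasFDerivAt_flow_re_im (A := A) (hγ w.im)).fderiv
  have hone (w : ℂ) : fderiv ℝ Γ w 1 = A (Γ w) := by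
    rw [hΓd]
    simp [hΓ]
  have hI (w : ℂ) : fderiv ℝ Γ w Complex.I = conjCross (Γ w) (A (Γ w)) := by
    rw [hΓd, ← flow_map, ← (hA.isSU_flow _).map_conjCross]
    simp
  have hsmooth : ContDiff ℝ ∞ Γ :=
    ((ContinuousLinearMap.restrictScalarsL ℂ C3 C3 ℝ ℝ).contDiff.comp
      ((contDiff_flow A).comp Complex.reCLM.contDiff)).clm_apply
      ((contDiff_infty_of_hasDerivAt (contDiff_conjCross_map A) hγ).comp Complex.imCLM.contDiff)
  refine ⟨Γ, ⟨⟨isOpen_univ, hsmooth.contDiffOn, fun w _ => ?_⟩, fun w _ => hone w⟩,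
    flow_zero_apply A _⟩
  have hAΓ : A (Γ w) = flow A w.re (A (γ w.im)) := (flow_map A _ _).symm
  refine .of_fderiv_one ?_ ?_ (by rw [hone, hI]) ?_
  · rw [hΓ, (hA.isSU_flow _).norm_map, hnorm, hv]
  · rw [hone, hAΓ, hΓ, (hA.isSU_flow _).inner_map, hA.inner_map_eq_of_hasDerivAt hγ _ 0, hvA]
  · rw [hone, hAΓ]
    exact (hA.isSU_flow _).map_ne_zero (map_ne_zero_of_hasDerivAt hγ hAv _)

theorem IsEquivariantSpecialOn.add_ofReal (h : IsEquivariantSpecialOn A F Set.univ) (w : ℂ)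
    (t : ℝ) : F (w + t) = flow A t (F w) := by
  have hd (s : ℝ) : HasDerivAt (fun s : ℝ => F (w + s)) (A (F (w + s))) s :=
    h.fderiv_one _ (Set.mem_univ _) ▸
      hasDerivAt_comp_add_ofReal (h.differentiableAt (Set.mem_univ _))
  simpa using eqOn_flow isOpen_univ isPreconnected_univ (Set.mem_univ 0) (fun s _ => hd s)
    (Set.mem_univ t)

end Equivariant

/-! ### Extension to the plane -/

section Extension

variable {F Γ : ℂ → C3} {f : ℂ → CP2} {S V : Set ℂ} {w w₀ : ℂ} {A : C3 →L[ℂ] C3}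
  {R : ℝ → Equiv.Perm CP2}

theorem IsMinimalLagrangianImmersion.exists_ball_isSpecialOn (hf : IsMinimalLagrangianImmersion f S)
    (hw : w ∈ S) : ∃ r F, 0 < r ∧ Metric.ball w r ⊆ S ∧ IsSpecialOn F (Metric.ball w r) ∧
      IsLiftOn F f (Metric.ball w r) := by
  obtain ⟨V, F, hwV, hVS, hF, hl⟩ := isMinimalLagrangianImmersion_iff_exists_isSpecialOn.1 hf w hw
  obtain ⟨r, hr, hrV⟩ := Metric.isOpen_iff.1 hF.isOpen w hwV
  exact ⟨r, F, hr, hrV.trans hVS, hF.mono Metric.isOpen_ball hrV, fun z hz => hl z (hrV hz)⟩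

theorem IsSpecialOn.isMinimalLagrangianImmersion (hF : IsSpecialOn F V) (hl : IsLiftOn F f V) :
    IsMinimalLagrangianImmersion f V :=
  isMinimalLagrangianImmersion_iff_exists_isSpecialOn.2 fun _ hp =>
    ⟨V, F, hp, subset_rfl, hF, hl⟩

theorem IsEquivariantSpecialOn.isLiftOn_of_isPreconnected
    (hΓ : IsEquivariantSpecialOn A Γ Set.univ) (hS : IsPreconnected S)
    (hloc : ∀ w ∈ S, ∃ V F, w ∈ V ∧ Convex ℝ V ∧ IsEquivariantSpecialOn A F V ∧ IsLiftOn F f V)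
    (hw₀ : w₀ ∈ S) (h : ∀ᶠ z in 𝓝 w₀, IsRep (Γ z) (f z)) : IsLiftOn Γ f S := by
  have hopen : IsOpen {w | ∀ᶠ z in 𝓝 w, IsRep (Γ z) (f z)} :=
    isOpen_iff_mem_nhds.2 fun w hw => eventually_eventually_nhds.2 hw
  have hsub : S ⊆ {w | ∀ᶠ z in 𝓝 w, IsRep (Γ z) (f z)} := by
    refine hS.subset_of_closure_inter_subset hopen ⟨w₀, hw₀, h⟩ ?_
    rintro w₁ ⟨hclosure, hw₁⟩
    obtain ⟨V, F, hw₁V, hV, hF, hl⟩ := hloc w₁ hw₁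
    obtain ⟨w₂, hw₂V, hw₂⟩ := mem_closure_iff.1 hclosure V hF.isOpen hw₁V
    obtain ⟨c, hc, hcF⟩ := (hΓ.mono hF.isOpen (Set.subset_univ V)).exists_eq_smul_of_eventually
      hF hV hw₂V (by
        filter_upwards [hw₂, hF.isOpen.mem_nhds hw₂V] with z hz hzV
        exact (hz.exists_smul (hl z hzV)).imp fun _ => And.right)
    filter_upwards [hF.isOpen.mem_nhds hw₁V] with z hz
    rw [hcF z hz]
    exact (hl z hz).smul (IsUnit.of_pow_eq_one hc three_ne_zero).ne_zero
  exact fun z hz => (hsub hz).self_of_nhds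

theorem IsEquivariantSpecialOn.exists_univ (hA : IsInfinitesimalSU A)
    (hF : IsEquivariantSpecialOn A F V) (hw₀ : w₀ ∈ V) :
    ∃ Γ, IsEquivariantSpecialOn A Γ Set.univ ∧ Γ w₀ = F w₀ := by
  have hs := hF.special w₀ hw₀
  obtain ⟨Γ, hΓ, hΓ0⟩ := hA.exists_isEquivariantSpecialOn_univ hs.norm_eq
    (by rw [← hF.fderiv_one w₀ hw₀, hs.horizontal]) (by
      rw [← hF.fderiv_one w₀ hw₀]
      exact hs.fderiv_one_ne_zero)
  exact ⟨fun w => Γ (w + -w₀), hΓ.comp_add_const (-w₀), by simpa using hΓ0⟩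

theorem IsMinimalLagrangianImmersion.exists_isEquivariantSpecialOn
    (hf : IsMinimalLagrangianImmersion f S) (hS : IsConnected S)
    (hR : IsEquivariant f S (fun t z => z + t) R) :
    ∃ A Γ, (∀ t v, InducesAt (flow A t) (R t) v) ∧ IsEquivariantSpecialOn A Γ Set.univ ∧
      IsLiftOn Γ f S := by
  obtain ⟨w₀, hw₀⟩ := hS.nonempty
  obtain ⟨r, F, hr, hrS, hF, hl⟩ := hf.exists_ball_isSpecialOn hw₀
  have hfR : ∀ t : ℝ, ∀ w ∈ S, f (w + t) = R t (f w) := fun t w hw => (hR.2 t w hw).2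
  obtain ⟨A, hA, hAR⟩ := hF.exists_generator hl hR.1 (fun t w hw => hfR t w (hrS hw)) hr
  have hequivariant {w : ℂ} {s : ℝ} {G : ℂ → C3} (hsS : Metric.ball w s ⊆ S)
      (hG : IsSpecialOn G (Metric.ball w s)) (hGl : IsLiftOn G f (Metric.ball w s)) :
      IsEquivariantSpecialOn A G (Metric.ball w s) :=
    ⟨hG, fun z hz => hG.fderiv_one_eq hGl (fun t w hw => hfR t w (hsS hw)) hA hAR hz⟩
  have hFA := hequivariant hrS hF hl
  have hw₀r : w₀ ∈ Metric.ball w₀ r := Metric.mem_ball_self hr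
  obtain ⟨Γ, hΓ, hΓ0⟩ := hFA.exists_univ hA hw₀r
  refine ⟨A, Γ, hAR, hΓ, hΓ.isLiftOn_of_isPreconnected hS.isPreconnected (fun w hw => ?_) hw₀ ?_⟩
  · obtain ⟨s, G, hs, hsS, hG, hGl⟩ := hf.exists_ball_isSpecialOn hw
    exact ⟨_, G, Metric.mem_ball_self hs, convex_ball w s, hequivariant hsS hG hGl, hGl⟩
  · filter_upwards [Metric.ball_mem_nhds w₀ hr] with z hz
    rw [(hΓ.mono Metric.isOpen_ball (Set.subset_univ _)).eqOn_of_eq hFA (convex_ball w₀ r) hw₀r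
      hΓ0 hz]
    exact hl z hz

theorem IsEquivariantSpecialOn.exists_add_eq_smul (hΓ : IsEquivariantSpecialOn A Γ Set.univ)
    (hl : IsLiftOn Γ f V) (hV : IsOpen V) (hne : V.Nonempty) {τ : ℂ}
    (hτ : ∀ w ∈ V, w + τ ∈ V ∧ f (w + τ) = f w) :
    ∃ c : ℂ, c ≠ 0 ∧ ∀ w, Γ (w + τ) = c • Γ w := by
  obtain ⟨w₀, hw₀⟩ := hne
  obtain ⟨c, hc, hcΓ⟩ := (hΓ.comp_add_const τ).exists_eq_smul_of_eventually hΓ convex_univ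
    (Set.mem_univ w₀) (by
      filter_upwards [hV.mem_nhds hw₀] with z hz
      have h := hl _ (hτ z hz).1
      rw [(hτ z hz).2] at h
      exact (h.exists_smul (hl z hz)).imp fun _ => And.right)
  exact ⟨c, (IsUnit.of_pow_eq_one hc three_ne_zero).ne_zero, fun w => hcΓ w (Set.mem_univ w)⟩

theorem IsMinimalLagrangianImmersion.isOpen (hf : IsMinimalLagrangianImmersion f S) : IsOpen S := by
  refine isOpen_iff_mem_nhds.2 fun p hp => ?_
  obtain ⟨V, F, hpV, hVS, hF, -⟩ := isMinimalLagrangianImmersion_iff_exists_isSpecialOn.1 hf p hp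
  exact Filter.mem_of_superset (hF.isOpen.mem_nhds hpV) hVS

theorem IsMinimalLagrangianImmersion.exists_translational_extension
    (hf : IsMinimalLagrangianImmersion f S) (hS : IsConnected S)
    (hR : IsEquivariant f S (fun t z => z + t) R) :
    ∃ g, IsMinimalLagrangianImmersion g Set.univ ∧ IsEquivariant g Set.univ (fun t z => z + t) R ∧
      Set.EqOn g f S ∧ ∀ τ, (∀ w ∈ S, w + τ ∈ S ∧ f (w + τ) = f w) → Function.Periodic g τ := by
  obtain ⟨A, Γ, hAR, hΓ, hl⟩ := hf.exists_isEquivariantSpecialOn hS hR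
  set g : ℂ → CP2 := fun w => Projectivization.mk ℂ (Γ w) (hΓ.special w (Set.mem_univ w)).ne_zero
  have hg (w : ℂ) : IsRep (Γ w) (g w) := .mk _
  refine ⟨g, hΓ.isMinimalLagrangianImmersion fun w _ => hg w,
    ⟨hR.1, fun t w _ => ⟨Set.mem_univ _, ?_⟩⟩, fun w hw => (hg w).unique (hl w hw), ?_⟩
  · have h := hg (w + t)
    rw [hΓ.add_ofReal] at h
    exact h.unique (hAR t _ _ (hg w))
  · intro τ hτ w
    obtain ⟨c, hc, hcΓ⟩ := hΓ.exists_add_eq_smul hl hf.isOpen hS.nonempty hτ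
    have h := hg (w + τ)
    rw [hcΓ] at h
    exact h.unique ((hg w).smul hc)

end Extension

/-! ### The covering of the punctured plane -/

section Covering

variable {f : ℂ → CP2} {M : Set ℂ} {R : ℝ → Equiv.Perm CP2} {I : Set ℝ} {p : ℂ}

/-- The covering `w ↦ e^{iw}` of the punctured plane by the plane, under which translations by reals
become rotations. -/
noncomputable def expI (w : ℂ) : ℂ := Complex.exp (Complex.I * w)

theorem expI_ne_zero (w : ℂ) : expI w ≠ 0 := Complex.exp_ne_zero _

theorem expI_add_ofReal (w : ℂ) (t : ℝ) : expI (w + t) = Complex.exp (t * Complex.I) * expI w := by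
  rw [expI, expI, mul_add, add_comm, Complex.exp_add, mul_comm (t : ℂ)]

theorem norm_expI (w : ℂ) : ‖expI w‖ = Real.exp (-w.im) := by
  simp [expI, Complex.norm_exp]

theorem expI_neg_I_mul_log {z : ℂ} (hz : z ≠ 0) : expI (-Complex.I * Complex.log z) = z := by
  rw [expI, ← mul_assoc, mul_neg, Complex.I_mul_I, neg_neg, one_mul, Complex.exp_log hz]

theorem hasDerivAt_expI (w : ℂ) : HasDerivAt expI (Complex.I * expI w) w :=
  ((hasDerivAt_id w).const_mul Complex.I).cexp.congr_deriv (by simp [expI, mul_comm])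

theorem periodic_expI : Function.Periodic expI (2 * Real.pi) := fun w => by
  have h := expI_add_ofReal w (2 * Real.pi)
  push_cast at h
  rwa [Complex.exp_two_pi_mul_I, one_mul] at h

theorem exists_comp_expI_eq {α : Type*} {f : ℂ → α} (hf : Function.Periodic f (2 * Real.pi : ℂ)) :
    ∃ g : ℂ → α, g ∘ expI = f := by
  refine ⟨fun z => f (-Complex.I * Complex.log z), funext fun w => ?_⟩
  obtain ⟨n, hn⟩ := Complex.exp_eq_exp_iff_exists_int.1
    (expI_neg_I_mul_log (expI_ne_zero w) : Complex.exp _ = Complex.exp _)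
  have hw : -Complex.I * Complex.log (expI w) = w + n * (2 * Real.pi : ℂ) :=
    mul_left_cancel₀ Complex.I_ne_zero (hn.trans (by ring))
  exact (congrArg f hw).trans (hf.int_mul n w)

theorem exists_expI_section (hp : p ≠ 0) :
    ∃ W φ, IsOpen W ∧ p ∈ W ∧ (∀ z ∈ W, HasDerivAt φ (-Complex.I / z) z) ∧
      ∀ z ∈ W, z ≠ 0 ∧ expI (φ z) = z := by
  have hne : ∀ z ∈ (· / p) ⁻¹' Complex.slitPlane, z ≠ 0 := fun z hz h0 =>
    Complex.slitPlane_ne_zero hz (by simp [h0])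
  refine ⟨(· / p) ⁻¹' Complex.slitPlane,
    fun z => -Complex.I * (Complex.log (z / p) + Complex.log p),
    Complex.isOpen_slitPlane.preimage (by fun_prop), by simp [hp], fun z hz => ?_, fun z hz => ?_⟩
  · have h := ((((hasDerivAt_id z).div_const p).clog hz).add_const (Complex.log p)).const_mul
      (-Complex.I)
    refine h.congr_deriv ?_
    have hz0 := hne z hz
    simp only [id_eq]
    field_simp
  · refine ⟨hne z hz, ?_⟩
    rw [expI, ← mul_assoc, mul_neg, Complex.I_mul_I, neg_neg, one_mul, Complex.exp_add,
      Complex.exp_log (Complex.slitPlane_ne_zero hz), Complex.exp_log hp, div_mul_cancel₀ _ hp]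

theorem IsMinimalLagrangianImmersion.of_forall_comp_eq {g : ℂ → CP2} {S : Set ℂ}
    (hf : IsMinimalLagrangianImmersion f M)
    (h : ∀ p ∈ S, ∃ (W : Set ℂ) (φ φ' : ℂ → ℂ), IsOpen W ∧ p ∈ W ∧
      (∀ z ∈ W, HasDerivAt φ (φ' z) z ∧ φ' z ≠ 0) ∧ φ p ∈ M ∧
        ∀ z ∈ W, φ z ∈ M → z ∈ S ∧ f (φ z) = g z) :
    IsMinimalLagrangianImmersion g S := by
  refine isMinimalLagrangianImmersion_iff_exists_isSpecialOn.2 fun p hp => ?_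
  obtain ⟨W, φ, φ', hW, hpW, hφ, hpM, hg⟩ := h p hp
  obtain ⟨V, F, hpV, hVM, hF, hl⟩ :=
    isMinimalLagrangianImmersion_iff_exists_isSpecialOn.1 hf _ hpM
  have hcont : ContinuousOn φ W := fun z hz => (hφ z hz).1.continuousAt.continuousWithinAt
  refine ⟨W ∩ φ ⁻¹' V, F ∘ φ, ⟨hpW, hpV⟩, fun z hz => (hg z hz.1 (hVM hz.2)).1,
    hF.comp (hcont.isOpen_inter_preimage hW hF.isOpen) (fun z hz => hz.2)
      (fun z hz => (hφ z hz.1).1) (fun z hz => (hφ z hz.1).2), fun z hz => ?_⟩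
  rw [← (hg z hz.1 (hVM hz.2)).2]
  exact hl _ hz.2

theorem isMinimalLagrangianImmersion_comp_expI (hM : M ⊆ puncturedPlane) :
    IsMinimalLagrangianImmersion (f ∘ expI) (expI ⁻¹' M) ↔ IsMinimalLagrangianImmersion f M := by
  refine ⟨fun h => IsMinimalLagrangianImmersion.of_forall_comp_eq h fun p hp => ?_,
    fun h => IsMinimalLagrangianImmersion.of_forall_comp_eq h fun p hp => ?_⟩
  · obtain ⟨W, φ, hW, hpW, hφ, hexp⟩ := exists_expI_section (hM hp)
    refine ⟨W, φ, fun z => -Complex.I / z, hW, hpW, fun z hz => ⟨hφ z hz,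
      div_ne_zero (neg_ne_zero.2 Complex.I_ne_zero) (hexp z hz).1⟩, ?_, fun z hz hzM => ?_⟩
    · rwa [Set.mem_preimage, (hexp p hpW).2]
    · rw [Set.mem_preimage, (hexp z hz).2] at hzM
      exact ⟨hzM, congrArg f (hexp z hz).2⟩
  · exact ⟨Set.univ, expI, _, isOpen_univ, Set.mem_univ p, fun z _ => ⟨hasDerivAt_expI z,
      mul_ne_zero Complex.I_ne_zero (expI_ne_zero z)⟩, hp, fun z _ hz => ⟨hz, rfl⟩⟩

theorem isEquivariant_comp_expI (hM : M ⊆ puncturedPlane) :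
    IsEquivariant (f ∘ expI) (expI ⁻¹' M) (fun t w => w + t) R ↔
      IsEquivariant f M (fun t z => Complex.exp (t * Complex.I) * z) R := by
  refine and_congr_right fun _ => forall_congr' fun t => ⟨fun h z hz => ?_, fun h w hw => ?_⟩
  · have hexp := expI_neg_I_mul_log (hM hz)
    have hz' := h (-Complex.I * Complex.log z) (by rwa [Set.mem_preimage, hexp])
    simpa only [Set.mem_preimage, Function.comp_apply, expI_add_ofReal, hexp] using hz'
  · simpa only [Set.mem_preimage, Function.comp_apply, expI_add_ofReal] using h (expI w) hw

theorem convex_expI_preimage_norm_preimage (hI : I.OrdConnected) :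
    Convex ℝ (expI ⁻¹' (norm ⁻¹' I)) := by
  have h : expI ⁻¹' (norm ⁻¹' I) = Complex.imLm ⁻¹' ((fun y => Real.exp (-y)) ⁻¹' I) := by
    ext w
    simp [norm_expI]
  rw [h]
  exact (hI.preimage_anti fun x y hxy =>
    Real.exp_le_exp.2 (neg_le_neg hxy)).convex.linear_preimage _

theorem isConnected_norm_preimage (hI : I.OrdConnected) (hne : I.Nonempty)
    (hpos : I ⊆ Set.Ioi 0) : IsConnected (norm ⁻¹' I : Set ℂ) := by
  have hrange : norm ⁻¹' I ⊆ Set.range expI := fun z hz =>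
    ⟨_, expI_neg_I_mul_log (norm_pos_iff.1 (hpos hz))⟩
  obtain ⟨x, hx⟩ := hne
  refine ⟨⟨x, by rwa [Set.mem_preimage, Complex.norm_of_nonneg (le_of_lt (hpos hx))]⟩, ?_⟩
  rw [← Set.image_preimage_eq_of_subset hrange]
  exact (convex_expI_preimage_norm_preimage hI).isPreconnected.image _
    fun w _ => (hasDerivAt_expI w).continuousAt.continuousWithinAt

theorem norm_preimage_norm_image_of_rotation (hM : M ⊆ puncturedPlane)
    (hrot : ∀ t : ℝ, ∀ z ∈ M, Complex.exp (t * Complex.I) * z ∈ M) :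
    norm ⁻¹' (norm '' M) = M := by
  refine Set.Subset.antisymm ?_ (Set.subset_preimage_image norm M)
  rintro z ⟨z', hz', hzz'⟩
  have hz0 : z' ≠ 0 := hM hz'
  have hunit : ‖z / z'‖ = 1 := by rw [norm_div, hzz', div_self (hzz' ▸ norm_ne_zero_iff.2 hz0)]
  have h := hrot (z / z').arg z' hz'
  have hpolar := Complex.norm_mul_exp_arg_mul_I (z / z')
  rw [hunit, Complex.ofReal_one, one_mul] at hpolar
  rwa [hpolar, div_mul_cancel₀ _ hz0] at h

theorem isConnected_expI_preimage (hM : IsConnected M) (hM0 : M ⊆ puncturedPlane)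
    (hrot : ∀ t : ℝ, ∀ z ∈ M, Complex.exp (t * Complex.I) * z ∈ M) :
    IsConnected (expI ⁻¹' M) := by
  obtain ⟨z, hz⟩ := hM.nonempty
  have hconvex := convex_expI_preimage_norm_preimage
    (hM.isPreconnected.image norm continuous_norm.continuousOn).ordConnected
  rw [norm_preimage_norm_image_of_rotation hM0 hrot] at hconvex
  exact hconvex.isConnected ⟨_, by rwa [Set.mem_preimage, expI_neg_I_mul_log (hM0 hz)]⟩

end Covering

theorem mainTheorem9_general (M : Set ℂ) (hM : IsConnected M) (hM0 : M ⊆ puncturedPlane)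
    (f : ℂ → CP2) (hf : IsMinimalLagrangianImmersion f M) (hrot : IsRotationallyEquivariant f M) :
    ∃ fExt fTilde : ℂ → CP2,
      (IsMinimalLagrangianImmersion fExt puncturedPlane ∧
        IsRotationallyEquivariant fExt puncturedPlane ∧
        Set.EqOn fExt f M) ∧
      (IsMinimalLagrangianImmersion fTilde Set.univ ∧
        IsTranslationallyEquivariant fTilde Set.univ ∧
        ∀ w : ℂ, fTilde (w + 2 * Real.pi) = fTilde w) ∧
      ∀ w : ℂ, fExt (Complex.exp (Complex.I * w)) = fTilde w := by
  obtain ⟨R, hR⟩ := hrot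
  have hS : IsConnected (expI ⁻¹' M) :=
    isConnected_expI_preimage hM hM0 fun t z hz => (hR.2 t z hz).1
  obtain ⟨g, hg, hgR, hgf, hper⟩ :=
    ((isMinimalLagrangianImmersion_comp_expI hM0).2 hf).exists_translational_extension hS
      ((isEquivariant_comp_expI hM0).2 hR)
  have hgper : Function.Periodic g (2 * Real.pi) := hper _ fun w hw =>
    ⟨by rwa [Set.mem_preimage, periodic_expI], congrArg f (periodic_expI w)⟩
  obtain ⟨fExt, rfl⟩ := exists_comp_expI_eq hgper
  have huniv : expI ⁻¹' puncturedPlane = Set.univ := Set.eq_univ_of_forall expI_ne_zero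
  have hExt : Set.EqOn fExt f M := fun z hz => by
    have hexp := expI_neg_I_mul_log (hM0 hz)
    simpa only [Function.comp_apply, hexp] using
      hgf (x := -Complex.I * Complex.log z) (by rwa [Set.mem_preimage, hexp])
  exact ⟨fExt, fExt ∘ expI,
    ⟨(isMinimalLagrangianImmersion_comp_expI subset_rfl).1 (by rwa [huniv]),
      ⟨R, (isEquivariant_comp_expI subset_rfl).1 (by rwa [huniv])⟩, hExt⟩,
    ⟨hg, ⟨R, hgR⟩, hgper⟩, fun _ => rfl⟩

theorem mainTheorem9 (M : Set ℂ)
    (hM : M = puncturedPlane ∨ M = puncturedDisk ∨ ∃ r : ℝ, 0 < r ∧ r < 1 ∧ M = openAnnulus r)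
    (f : ℂ → CP2) (hf : IsMinimalLagrangianImmersion f M) (hrot : IsRotationallyEquivariant f M) :
    ∃ fExt fTilde : ℂ → CP2,
      (IsMinimalLagrangianImmersion fExt puncturedPlane ∧
        IsRotationallyEquivariant fExt puncturedPlane ∧
        Set.EqOn fExt f M) ∧
      (IsMinimalLagrangianImmersion fTilde Set.univ ∧
        IsTranslationallyEquivariant fTilde Set.univ ∧
        ∀ w : ℂ, fTilde (w + 2 * Real.pi) = fTilde w) ∧
      ∀ w : ℂ, fExt (Complex.exp (Complex.I * w)) = fTilde w := by
  obtain ⟨I, hI, hne, hpos, rfl⟩ : ∃ I : Set ℝ, I.OrdConnected ∧ I.Nonempty ∧ I ⊆ Set.Ioi 0 ∧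
      M = norm ⁻¹' I := by
    rcases hM with rfl | rfl | ⟨r, hr0, hr1, rfl⟩
    · exact ⟨Set.Ioi 0, Set.ordConnected_Ioi, Set.nonempty_Ioi, subset_rfl,
        Set.ext fun z => norm_pos_iff.symm⟩
    · exact ⟨Set.Ioo 0 1, Set.ordConnected_Ioo, Set.nonempty_Ioo.2 one_pos,
        Set.Ioo_subset_Ioi_self, rfl⟩
    · exact ⟨Set.Ioo r (1 / r), Set.ordConnected_Ioo,
        Set.nonempty_Ioo.2 (hr1.trans ((one_lt_div hr0).2 hr1)),
        fun x hx => hr0.trans hx.1, rfl⟩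
  exact mainTheorem9_general _ (isConnected_norm_preimage hI hne hpos)
    (fun z hz => norm_pos_iff.1 (hpos hz)) f hf hrot
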